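/- **Setting.** Let $\alpha,\beta:[0,1]\to\mathbb R$ be continuously differentiable with $\alpha(0)=\beta(1)=1$, $\alpha(1)=\beta(0)=0$, $\alpha\ge 0$, $\dot\alpha\le 0$, $\dot\beta\ge 0$ on $[0,1]$ and $\beta>0$ on $(0,1]$. For a probability measure $P_0$ on $\mathbb R^N$ with bounded support let $\mathbf y(t)=\alpha(t)\mathbf x_0+\beta(t)\mathbf z$ with independent $\mathbf x_0\sim P_0$, $\mathbf z\sim\mathcal N(0,I_N)$. For $t\in(0,1]$ the posterior law of $\mathbf x_0$ given $\mathbf y(t)=\mathbf y$ is $$P_{t,\mathbf y}(d\mathbf x)=\frac1{Z(\mathbf y)}\exp\Big(\frac{\alpha(t)}{\beta(t)^2}\langle \mathbf y,\mathbf x\rangle-\frac{\alpha(t)^2}{2\beta(t)^2}\|\mathbf x\|^2\Big)P_0(d\mathbf x),$$ the perfect denoiser is $\hat{\mathbf x}_0(\mathbf y,t)=\mathbb E[\mathbf x_0\mid \mathbf y(t)=\mathbf y]=\int \mathbf x\,P_{t,\mathbf y}(d\mathbf x)$, and the velocity field is $$b(\mathbf y,t)=\mathbb E[\dot\alpha(t)\mathbf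 x_0+\dot\beta(t)\mathbf z\mid \mathbf y(t)=\mathbf y]=\int\Big(\dot\alpha(t)\mathbf x+\dot\beta(t)\,\frac{\mathbf y-\alpha(t)\mathbf x}{\beta(t)}\Big)P_{t,\mathbf y}(d\mathbf x).$$ **Algorithm.** Given $\epsilon\in(0,1)$ and $N_{\rm steps}\ge 1$, put $\delta=(1-\epsilon)/N_{\rm steps}$ and $t_l=1-l\delta$. Start from $\mathbf Y_{t_0}=\mathbf Z\sim\mathcal N(0,I_N)$ and, for $l=0,\dots,N_{\rm steps}-1$, compute $\hat{\mathbf x}_0=\hat{\mathbf x}_0(\mathbf Y_{t_l},t_l)$ with the perfect denoiser and set $$\mathbf Y_{t_{l+1}}=\Big(1-\delta\frac{\dot\beta(t_l)}{\beta(t_l)}\Big)\mathbf Y_{t_l}-\delta\Big(\dot\alpha(t_l)-\frac{\dot\beta(t_l)\alpha(t_l)}{\beta(t_l)}\Big)\hat{\mathbf x}_0,$$ which is the Euler step $\mathbf Y_{t_{l+1}}=\mathbf Y_{t_l}-\delta\, b(\mathbf Y_{t_l},t_l)$. Let $P_{{\rm alg},N_{\rm steps}}$ be the law of the final state $\mathbf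 Y_\epsilon=\mathbf Y_{t_{N_{\rm steps}}}$, and let $\hat P_{{\rm alg},N_{\rm steps}}$ be the law of the last denoised vector $\hat{\mathbf x}_0(\mathbf Y_{t_l},t_l)$, $l=N_{\rm steps}-1$. **Assumptions**, with constants $R$, $L_\tau$, $M_{\tau,K}$ (for $\tau\in(0,1)$, $K>0$) that do not depend on $N$: 1. $\operatorname{supp}P_0\subseteq\{\mathbf x\in\mathbb R^N:\|\mathbf x\|\le R\sqrt N\}$; 2. for all $\tau\in(0,1)$, $t\in(\tau,1)$, $\mathbf y\in\mathbb R^N$, the Jacobian satisfies $\|\partial b(\mathbf y,t)/\partial\mathbf y\|_2\le L_\tau$ (spectral norm); 3. for all $\tau\in(0,1)$, $K>0$, $t\in(\tau,1)$ and $\mathbf y\in\mathbb R^N$ with $\|\mathbf y\|\le K\sqrt N$, $b(\mathbf y,\cdot)$ is differentiable at $t$ and $\|\partial_t b(\mathbf y,t)\|\le M_{\tau,K}\sqrt N$. **Theorem.** For every $\eta>0$ there are $\epsilon\in(0,1)$ and $N_{\rm steps}\ge1$, depending only on $\eta,\alpha,\beta$ and the constants $R,(L_\tau)_\tau,(M_{\tau,K})_{\tau,K}$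 and in particular not on $N$, such that for every $N\ge1$ and every probability measure $P_0$ on $\mathbb R^N$ satisfying 1–3, $$\frac1{\sqrt N}W_2(P_{{\rm alg},N_{\rm steps}},P_0)<\eta\qquad\text{and}\qquad \frac1{\sqrt N}W_2(\hat P_{{\rm alg},N_{\rm steps}},P_0)<\eta,$$ where $W_2(\mu,\nu)^2=\inf\mathbb E\|\mathbf X-\mathbf Y\|^2$ over all couplings of $\mathbf X\sim\mu$, $\mathbf Y\sim\nu$. -/

import Mathlib

open MeasureTheory ProbabilityTheory Set

/-- The `N`-dimensional Euclidean space. -/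
abbrev Euc (N : ℕ) : Type := EuclideanSpace ℝ (Fin N)

/-- The time derivative on the interval `[0,1]` (one-sided at the two endpoints). -/
noncomputable def timeDeriv (f : ℝ → ℝ) (t : ℝ) : ℝ := derivWithin f (Icc 0 1) t

/-- The coefficients of a one-sided stochastic interpolant
`y(t) = α(t) x₀ + β(t) z`, `t ∈ [0,1]`, from the target (`t = 0`) to Gaussian noise (`t = 1`). -/
structure IsInterpolant (α β : ℝ → ℝ) : Prop where
  contDiff_alpha : ContDiffOn ℝ 1 α (Icc 0 1)
  contDiff_beta : ContDiffOn ℝ 1 β (Icc 0 1)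
  alpha_zero : α 0 = 1
  alpha_one : α 1 = 0
  beta_zero : β 0 = 0
  beta_one : β 1 = 1
  alpha_nonneg : ∀ t ∈ Icc (0 : ℝ) 1, 0 ≤ α t
  deriv_alpha_nonpos : ∀ t ∈ Icc (0 : ℝ) 1, timeDeriv α t ≤ 0
  beta_pos : ∀ t ∈ Ioc (0 : ℝ) 1, 0 < β t
  deriv_beta_nonneg : ∀ t ∈ Icc (0 : ℝ) 1, 0 ≤ timeDeriv β t

section Flow

variable {N : ℕ} (α β : ℝ → ℝ) (P₀ : Measure (Euc N))

/-- The posterior (tilted) law of `x₀` given `y(t) = y`, i.e. the probability measure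
`Z(y)⁻¹ exp (α/β² ⟨y, x⟩ - α²/(2β²) ‖x‖²) P₀(dx)`. -/
noncomputable def tiltedPosterior (t : ℝ) (y : Euc N) : Measure (Euc N) :=
  P₀.tilted fun x => α t / β t ^ 2 * inner ℝ y x - α t ^ 2 / (2 * β t ^ 2) * ‖x‖ ^ 2

/-- The perfect denoiser `E[x₀ | y(t) = y]`. -/
noncomputable def denoiser (t : ℝ) (y : Euc N) : Euc N :=
  ∫ x, x ∂(tiltedPosterior α β P₀ t y)

/-- The velocity field `b(y,t) = E[α'(t) x₀ + β'(t) z | y(t) = y]`; on the event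
`y(t) = y`, `x₀ = x` the noise is `z = (y - α(t) x) / β(t)`. -/
noncomputable def velocity (t : ℝ) (y : Euc N) : Euc N :=
  ∫ x, (timeDeriv α t • x + timeDeriv β t • ((β t)⁻¹ • (y - α t • x)))
    ∂(tiltedPosterior α β P₀ t y)

/-- One update of the sampling algorithm at time `t` with step `δ`: it sends `Y_t` to `Y_{t-δ}`. -/
noncomputable def algStep (δ t : ℝ) (y : Euc N) : Euc N :=
  (1 - δ * (timeDeriv β t / β t)) • y
    - (δ * (timeDeriv α t - timeDeriv β t * α t / β t)) • denoiser α β P₀ t y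

/-- The state `Y_{1 - l δ}` of the algorithm after `l` updates, started from `Y_1 = z`. -/
noncomputable def algState (δ : ℝ) : ℕ → Euc N → Euc N
  | 0, z => z
  | l + 1, z => algStep α β P₀ δ (1 - l * δ) (algState δ l z)

/-- The estimate `x̂₀` computed from the current state in the iteration with index `l`
(at time `1 - l δ`, after `l` updates). -/
noncomputable def algEstimate (δ : ℝ) (l : ℕ) (z : Euc N) : Euc N :=
  denoiser α β P₀ (1 - l * δ) (algState α β P₀ δ l z)

/-- The law of the final state `Y_ε` when the algorithm is run from time `1` to time `ε`
with `n` equal steps, from standard Gaussian noise. -/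
noncomputable def algStateLaw (ε : ℝ) (n : ℕ) : Measure (Euc N) :=
  (stdGaussian (Euc N)).map (algState α β P₀ ((1 - ε) / n) n)

/-- The law of the last estimate `x̂₀` computed in that run, i.e. in iteration `n - 1`. -/
noncomputable def algEstimateLaw (ε : ℝ) (n : ℕ) : Measure (Euc N) :=
  (stdGaussian (Euc N)).map (algEstimate α β P₀ ((1 - ε) / n) (n - 1))

end Flow

/-- The 2-Wasserstein distance: the square root of the infimum of `E ‖X - Y‖²` over all
couplings of `μ` and `ν`. -/
noncomputable def wasserstein2 {N : ℕ} (μ ν : Measure (Euc N)) : ENNReal :=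
  (⨅ π ∈ {π : Measure (Euc N × Euc N) | π.map Prod.fst = μ ∧ π.map Prod.snd = ν},
    ∫⁻ p, ENNReal.ofReal (‖p.1 - p.2‖ ^ 2) ∂π) ^ (1 / 2 : ℝ)

/-!
The sampler is the Euler scheme for the transport equation `dY/dt = b(Y, t)`, run backwards from
noise at time `1` to time `ε`. The proof compares its final state with an exact sample of the
interpolant `y(ε) = α(ε) x₀ + β(ε) z`, and then `y(ε)` with `x₀`. The flow of the equation is never
constructed: an exact sample of `y(ε)` is obtained as the limit of Euler schemes with ever smaller
steps.

*Identification of the limit.* The residual `x₀ - x̂₀(y(t), t)` is orthogonal to every function of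
`y(t)` (`integral_clm_apply_sub_denoiser`): by the Cameron–Martin formula the joint law of
`(x₀, y(t))` has a density with respect to a product measure, under which the posterior mean can be
integrated out. Consequently `α' x₀ + β' z - b(y(t), t)`, a multiple of that residual, drops out of
the first-order Taylor expansion of `E u(y(t - h))`, and one Euler step reproduces this expectation
up to `o(h)` for every test function `u` with Lipschitz derivative. Such test functions are stable
under composition with an Euler step (`HasC11Bound.comp_eulerStep`), so the errors add up to `o(1)`
(`exists_weakError_lt`). The constants here may depend on `P₀` and on `N`. Applied to characters,
this shows that a pointwise limit of Euler schemes has the law of the interpolant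
(`map_limitState_eq`).

*Dimension-free error bound.* Started in the ball of radius `K √N`, the scheme stays in a ball of
radius `K' √N`, on which the field is Lipschitz in space, and Lipschitz in time with constant
`M √N`. Halving the step `δ` then moves the scheme by `O(δ √N)` (`IsEulerScheme.norm_sub_half_le`),
so repeated halving converges, to a limit within `O(δ √N)` of the original scheme, with constants
that depend neither on `N` nor on `P₀`. Starting points outside the ball are handled with linear
growth and the fourth moment of the Gaussian, which is `O(N²)`; the outcome is the mean-square bound
`exists_limitState`.

*Transfer to the target.* The limit is a function of the initial noise with the law of `y(t)`, so it
can be glued to the pair `(y(t), x₀)` (`exists_glued_measure`); this bounds `W₂` between the law of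
the final state and `P₀` by the error of the scheme plus the mean square of `y(t) - x₀`, which is
`N` times a quantity vanishing as `t → 0`. For the last denoised vector the denoiser is applied
along the coupling. It is at least as good an estimate of `x₀` as `y(t)`
(`integral_norm_denoiser_sub_sq_le`), and it inherits a dimension-free Lipschitz bound from the
velocity field at times where its coefficient in that field does not vanish
(`norm_denoiser_sub_le`). Arbitrarily small such times exist, since `β` increases from `0`
(`exists_time_denoiserCoeff_ne_zero`); `ε` is chosen among them.
-/

/-! ### The standard Gaussian measure -/

/-- The joint Laplace and Fourier transform of the standard Gaussian measure, which factorizes over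
the coordinates. -/
lemma integral_cexp_inner_stdGaussian {N : ℕ} (a b : Euc N) :
    ∫ z, Complex.exp ((inner ℝ a z : ℝ) + (inner ℝ b z : ℝ) * Complex.I) ∂(stdGaussian (Euc N)) =
      Complex.exp (((‖a‖ ^ 2 - ‖b‖ ^ 2) / 2 : ℝ) + (inner ℝ a b : ℝ) * Complex.I) := by
  rw [← map_pi_eq_stdGaussian, integral_map (by fun_prop)
    (Measurable.aestronglyMeasurable (by fun_prop))]
  have h : ∀ x : Fin N → ℝ, Complex.exp ((inner ℝ a (WithLp.toLp 2 x) : ℝ) +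
      (inner ℝ b (WithLp.toLp 2 x) : ℝ) * Complex.I) =
      ∏ i, Complex.exp (((a i : ℂ) + b i * Complex.I) * x i) := by
    intro x
    rw [← Complex.exp_sum]
    congr 1
    simp only [PiLp.inner_apply, RCLike.inner_apply, conj_trivial]
    push_cast
    rw [Finset.sum_mul, ← Finset.sum_add_distrib]
    refine Finset.sum_congr rfl fun i _ => ?_
    ring
  simp_rw [h]
  rw [integral_fintype_prod_eq_prod
    (f := fun i (x : ℝ) => Complex.exp (((a i : ℂ) + b i * Complex.I) * x))]
  have h2 : ∀ i, ∫ x : ℝ, Complex.exp (((a i : ℂ) + b i * Complex.I) * x) ∂(gaussianReal 0 1) =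
      Complex.exp (((a i : ℂ) + b i * Complex.I) ^ 2 / 2) := by
    intro i
    have := complexMGF_id_gaussianReal (μ := 0) (v := 1) ((a i : ℂ) + b i * Complex.I)
    simpa [complexMGF] using this
  simp_rw [h2]
  rw [← Complex.exp_sum]
  congr 1
  simp only [PiLp.inner_apply, RCLike.inner_apply, conj_trivial, EuclideanSpace.real_norm_sq_eq]
  push_cast
  rw [← Finset.sum_sub_distrib, Finset.sum_mul, Finset.sum_div, ← Finset.sum_add_distrib]
  refine Finset.sum_congr rfl fun i _ => ?_
  ring_nf
  rw [Complex.I_sq]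
  ring

lemma integrable_exp_mul_norm_stdGaussian {N : ℕ} (c : ℝ) :
    Integrable (fun z : Euc N => Real.exp (c * ‖z‖)) (stdGaussian (Euc N)) := by
  obtain ⟨C, hC, hint⟩ := IsGaussian.exists_integrable_exp_sq (stdGaussian (Euc N))
  refine (hint.const_mul (Real.exp (c ^ 2 / (4 * C)))).mono'
    (Measurable.aestronglyMeasurable (by fun_prop)) (Filter.Eventually.of_forall fun z => ?_)
  rw [Real.norm_eq_abs, Real.abs_exp, ← Real.exp_add]
  refine Real.exp_le_exp.2 ?_
  -- completing the square, `c ‖z‖ ≤ c² / (4 C) + C ‖z‖²`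
  have : c ^ 2 / (4 * C) + C * ‖z‖ ^ 2 - c * ‖z‖ = (c - 2 * C * ‖z‖) ^ 2 / (4 * C) := by
    field_simp; ring
  have h2 : 0 ≤ (c - 2 * C * ‖z‖) ^ 2 / (4 * C) := by positivity
  linarith

lemma integrable_exp_inner_stdGaussian {N : ℕ} (a : Euc N) :
    Integrable (fun z : Euc N => Real.exp (inner ℝ a z)) (stdGaussian (Euc N)) := by
  refine (integrable_exp_mul_norm_stdGaussian ‖a‖).mono'
    (Measurable.aestronglyMeasurable (by fun_prop)) (Filter.Eventually.of_forall fun z => ?_)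
  rw [Real.norm_eq_abs, Real.abs_exp]
  exact Real.exp_le_exp.2 (real_inner_le_norm a z)

lemma integral_exp_inner_stdGaussian {N : ℕ} (a : Euc N) :
    ∫ z, Real.exp (inner ℝ a z) ∂(stdGaussian (Euc N)) = Real.exp (‖a‖ ^ 2 / 2) := by
  have := integral_cexp_inner_stdGaussian a 0
  simp only [inner_zero_left, Complex.ofReal_zero, zero_mul, add_zero, norm_zero,
    inner_zero_right, ← Complex.ofReal_exp] at this
  rw [integral_complex_ofReal] at this
  simpa using Complex.ofReal_injective this

/-- The Cameron–Martin formula in finite dimension: translating the standard Gaussian measure by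
`a` amounts to tilting it by `⟪a, ·⟫`. -/
lemma map_const_add_stdGaussian {N : ℕ} (a : Euc N) :
    (stdGaussian (Euc N)).map (fun z => a + z) =
      (stdGaussian (Euc N)).tilted (fun z => inner ℝ a z) := by
  have := isProbabilityMeasure_tilted (integrable_exp_inner_stdGaussian a)
  have : IsProbabilityMeasure ((stdGaussian (Euc N)).map (fun z => a + z)) :=
    Measure.isProbabilityMeasure_map (by fun_prop)
  refine Measure.ext_of_charFun ?_
  ext ξ
  rw [charFun_apply, charFun_apply, integral_tilted, integral_map (by fun_prop)
    (Measurable.aestronglyMeasurable (by fun_prop)), integral_exp_inner_stdGaussian]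
  have h1 := integral_cexp_inner_stdGaussian a ξ
  have h2 := integral_cexp_inner_stdGaussian 0 ξ
  simp only [inner_zero_left, Complex.ofReal_zero, zero_mul, add_zero, norm_zero, zero_add] at h2
  have e1 : ∀ z, (Real.exp (inner ℝ a z) / Real.exp (‖a‖ ^ 2 / 2)) •
      Complex.exp ((inner ℝ z ξ : ℝ) * Complex.I) = Complex.exp (-(‖a‖ ^ 2 / 2 : ℝ)) *
      Complex.exp ((inner ℝ a z : ℝ) + (inner ℝ ξ z : ℝ) * Complex.I) := by
    intro z
    rw [← Real.exp_sub, Complex.real_smul, Complex.ofReal_exp, ← Complex.exp_add,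
      ← Complex.exp_add, real_inner_comm ξ z]
    congr 1
    push_cast
    ring
  have e2 : ∀ z, Complex.exp ((inner ℝ (a + z) ξ : ℝ) * Complex.I) =
      Complex.exp ((inner ℝ a ξ : ℝ) * Complex.I) *
        Complex.exp ((inner ℝ ξ z : ℝ) * Complex.I) := by
    intro z
    rw [← Complex.exp_add, inner_add_left, real_inner_comm ξ z]
    congr 1
    push_cast
    ring
  simp_rw [e1, e2]
  rw [integral_const_mul, integral_const_mul, h1, h2, ← Complex.exp_add, ← Complex.exp_add]
  congr 1
  push_cast
  ring

lemma integral_comp_const_add_stdGaussian {N : ℕ} {F : Type*} [NormedAddCommGroup F]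
    [NormedSpace ℝ F] (a : Euc N) {f : Euc N → F} (hf : Continuous f) :
    ∫ z, f (a + z) ∂(stdGaussian (Euc N)) =
      ∫ z, Real.exp (inner ℝ a z - ‖a‖ ^ 2 / 2) • f z ∂(stdGaussian (Euc N)) := by
  rw [← integral_map (φ := fun z => a + z) (f := f) (by fun_prop) hf.aestronglyMeasurable,
    map_const_add_stdGaussian, integral_tilted, integral_exp_inner_stdGaussian]
  simp_rw [Real.exp_sub]

lemma integrable_norm_pow_stdGaussian {N : ℕ} (k : ℕ) :
    Integrable (fun z : Euc N => ‖z‖ ^ k) (stdGaussian (Euc N)) := by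
  have := (IsGaussian.memLp_id (stdGaussian (Euc N)) k (by simp)).integrable_norm_pow'
  simpa using this

lemma integral_norm_sq_stdGaussian {N : ℕ} :
    ∫ z, ‖z‖ ^ 2 ∂(stdGaussian (Euc N)) = N := by
  rw [← map_pi_eq_stdGaussian, integral_map (by fun_prop)
    (Measurable.aestronglyMeasurable (by fun_prop))]
  simp_rw [EuclideanSpace.real_norm_sq_eq]
  have hm : Integrable (fun x : ℝ => x ^ 2) (gaussianReal 0 1) := by
    simpa using (memLp_id_gaussianReal (μ := 0) (v := 1) 2).integrable_norm_pow'
  rw [integral_finsetSum _ fun i _ => integrable_comp_eval (i := i) hm]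
  have h1 : ∫ x, x ^ 2 ∂(gaussianReal 0 1) = 1 := by
    have := variance_fun_id_gaussianReal (μ := 0) (v := 1)
    rw [variance_eq_integral (by fun_prop)] at this
    simpa using this
  have h2 : ∀ i : Fin N, ∫ x : Fin N → ℝ, x i ^ 2 ∂(Measure.pi fun _ => gaussianReal 0 1) = 1 := by
    intro i
    rw [integral_comp_eval (X := fun _ : Fin N => ℝ) (μ := fun _ => gaussianReal 0 1)
      (i := i) (f := fun x : ℝ => x ^ 2) (Measurable.aestronglyMeasurable (by fun_prop)), h1]
  simp [h2]

/-- The fourth moment is `O(N²)`; the one-dimensional constant is left unevaluated because only its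
independence of `N` matters. -/
lemma integral_norm_pow_four_stdGaussian_le {N : ℕ} :
    ∫ z, ‖z‖ ^ 4 ∂(stdGaussian (Euc N)) ≤ N ^ 2 * ∫ x, x ^ 4 ∂(gaussianReal 0 1) := by
  rw [← map_pi_eq_stdGaussian, integral_map (by fun_prop)
    (Measurable.aestronglyMeasurable (by fun_prop))]
  have hm : Integrable (fun x : ℝ => x ^ 4) (gaussianReal 0 1) := by
    have := (memLp_id_gaussianReal (μ := 0) (v := 1) 4).integrable_norm_pow'
    refine (this.congr (Filter.Eventually.of_forall fun x => ?_))
    simp only [id, Real.norm_eq_abs]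
    exact (show Even 4 by decide).pow_abs x
  have h2 : ∀ i : Fin N, ∫ x : Fin N → ℝ, x i ^ 4 ∂(Measure.pi fun _ => gaussianReal 0 1) =
      ∫ x, x ^ 4 ∂(gaussianReal 0 1) := by
    intro i
    rw [integral_comp_eval (X := fun _ : Fin N => ℝ) (μ := fun _ => gaussianReal 0 1)
      (i := i) (f := fun x : ℝ => x ^ 4) (Measurable.aestronglyMeasurable (by fun_prop))]
  have hint : Integrable (fun x : Fin N → ℝ => (N : ℝ) * ∑ i, x i ^ 4)
      (Measure.pi fun _ => gaussianReal 0 1) :=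
    (integrable_finsetSum _ fun i _ => integrable_comp_eval (X := fun _ : Fin N => ℝ)
      (μ := fun _ => gaussianReal 0 1) (i := i) hm).const_mul _
  calc _ ≤ ∫ x : Fin N → ℝ, (N : ℝ) * ∑ i, x i ^ 4 ∂(Measure.pi fun _ => gaussianReal 0 1) := by
        refine integral_mono_of_nonneg (Filter.Eventually.of_forall fun x => by positivity) hint
          (Filter.Eventually.of_forall fun x => ?_)
        have h := sq_sum_le_card_mul_sum_sq (s := (Finset.univ : Finset (Fin N)))
          (f := fun i => x i ^ 2)
        simp only [Finset.card_univ, Fintype.card_fin, ← pow_mul] at h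
        calc ‖WithLp.toLp 2 x‖ ^ 4 = (‖WithLp.toLp 2 x‖ ^ 2) ^ 2 := by ring
          _ = (∑ i, x i ^ 2) ^ 2 := by rw [EuclideanSpace.real_norm_sq_eq]
          _ ≤ _ := h
    _ = _ := by
        rw [integral_const_mul, integral_finsetSum _ fun i _ => integrable_comp_eval (i := i) hm]
        simp [h2]
        ring

/-! ### Exponential tilts of a bounded law -/

section Tilt

variable {N : ℕ} {P : Measure (Euc N)} {ρ : ℝ} {F : Type*} [NormedAddCommGroup F] [NormedSpace ℝ F]

/-- The law `P` tilted by a linear and a centred quadratic term: the exponential family in which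
all the posteriors lie, with the coefficients `c = α / β²` and `d = α² / (2 β²)` kept abstract. -/
noncomputable def quadTilt (P : Measure (Euc N)) (c d : ℝ) (y : Euc N) : Measure (Euc N) :=
  P.tilted fun x => c * inner ℝ y x - d * ‖x‖ ^ 2

lemma quad_le {ρ : ℝ} (c d : ℝ) (y : Euc N) {x : Euc N} (hx : ‖x‖ ≤ ρ) :
    c * inner ℝ y x - d * ‖x‖ ^ 2 ≤ |c| * ‖y‖ * ρ + |d| * ρ ^ 2 := by
  have h1 : c * inner ℝ y x ≤ |c| * ‖y‖ * ρ := by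
    refine (le_abs_self _).trans ?_
    rw [abs_mul, mul_assoc]
    refine mul_le_mul_of_nonneg_left ?_ (abs_nonneg c)
    exact (abs_real_inner_le_norm y x).trans (by gcongr)
  have h2 : -(d * ‖x‖ ^ 2) ≤ |d| * ρ ^ 2 := by
    refine (neg_le_abs _).trans ?_
    rw [abs_mul, abs_of_nonneg (sq_nonneg ‖x‖)]
    gcongr
  linarith

lemma norm_exp_smul_le {c d C D Y B ρ : ℝ} {y x : Euc N} {v : F} (hc : |c| ≤ C) (hd : |d| ≤ D)
    (hy : ‖y‖ ≤ Y) (hx : ‖x‖ ≤ ρ) (hv : ‖v‖ ≤ B) :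
    ‖Real.exp (c * inner ℝ y x - d * ‖x‖ ^ 2) • v‖ ≤ Real.exp (C * Y * ρ + D * ρ ^ 2) * B := by
  have hρ : 0 ≤ ρ := (norm_nonneg x).trans hx
  have hC : 0 ≤ C := (abs_nonneg c).trans hc
  rw [norm_smul, Real.norm_eq_abs, Real.abs_exp]
  refine mul_le_mul (Real.exp_le_exp.2 ((quad_le c d y hx).trans ?_)) hv (norm_nonneg v)
    (Real.exp_nonneg _)
  gcongr

lemma aestronglyMeasurable_exp_quad_smul {f : Euc N → F} (hf : AEStronglyMeasurable f P)
    (c d : ℝ) (y : Euc N) :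
    AEStronglyMeasurable (fun x => Real.exp (c * inner ℝ y x - d * ‖x‖ ^ 2) • f x) P :=
  (Measurable.aestronglyMeasurable (by fun_prop)).smul hf

lemma integrable_exp_quad_smul [IsFiniteMeasure P] (hP : ∀ᵐ x ∂P, ‖x‖ ≤ ρ) {f : Euc N → F}
    (hf : AEStronglyMeasurable f P) {B : ℝ} (hB : ∀ᵐ x ∂P, ‖f x‖ ≤ B) (c d : ℝ) (y : Euc N) :
    Integrable (fun x => Real.exp (c * inner ℝ y x - d * ‖x‖ ^ 2) • f x) P := by
  refine (integrable_const (Real.exp (|c| * ‖y‖ * ρ + |d| * ρ ^ 2) * B)).mono'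
    (aestronglyMeasurable_exp_quad_smul hf c d y) ?_
  filter_upwards [hP, hB] with x hx hB
  exact norm_exp_smul_le le_rfl le_rfl le_rfl hx hB

lemma integrable_exp_quad [IsFiniteMeasure P] (hP : ∀ᵐ x ∂P, ‖x‖ ≤ ρ) (c d : ℝ) (y : Euc N) :
    Integrable (fun x => Real.exp (c * inner ℝ y x - d * ‖x‖ ^ 2)) P := by
  simpa using integrable_exp_quad_smul (f := fun _ => (1 : ℝ)) (B := 1) hP
    aestronglyMeasurable_const (by simp) c d y

lemma integral_exp_quad_pos [IsProbabilityMeasure P] (hP : ∀ᵐ x ∂P, ‖x‖ ≤ ρ) (c d : ℝ)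
    (y : Euc N) : 0 < ∫ x, Real.exp (c * inner ℝ y x - d * ‖x‖ ^ 2) ∂P :=
  integral_exp_pos (integrable_exp_quad hP c d y)

lemma isProbabilityMeasure_quadTilt [IsProbabilityMeasure P] (hP : ∀ᵐ x ∂P, ‖x‖ ≤ ρ) (c d : ℝ)
    (y : Euc N) : IsProbabilityMeasure (quadTilt P c d y) :=
  isProbabilityMeasure_tilted (integrable_exp_quad hP c d y)

lemma integral_quadTilt (f : Euc N → F) (c d : ℝ) (y : Euc N) :
    ∫ x, f x ∂(quadTilt P c d y) =
      (∫ x, Real.exp (c * inner ℝ y x - d * ‖x‖ ^ 2) ∂P)⁻¹ •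
        ∫ x, Real.exp (c * inner ℝ y x - d * ‖x‖ ^ 2) • f x ∂P := by
  rw [quadTilt, integral_tilted, ← integral_smul]
  refine integral_congr_ae (Filter.Eventually.of_forall fun x => ?_)
  simp only [smul_smul, div_eq_inv_mul]

lemma ae_quadTilt {p : Euc N → Prop} (h : ∀ᵐ x ∂P, p x) (c d : ℝ) (y : Euc N) :
    ∀ᵐ x ∂(quadTilt P c d y), p x :=
  (tilted_absolutelyContinuous P _).ae_le h

omit [NormedSpace ℝ F] in
lemma integrable_quadTilt [IsProbabilityMeasure P] (hP : ∀ᵐ x ∂P, ‖x‖ ≤ ρ) {f : Euc N → F}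
    (hf : AEStronglyMeasurable f P) {B : ℝ} (hB : ∀ᵐ x ∂P, ‖f x‖ ≤ B) (c d : ℝ) (y : Euc N) :
    Integrable f (quadTilt P c d y) := by
  have := isProbabilityMeasure_quadTilt hP c d y
  exact (integrable_const B).mono' (hf.mono_ac (tilted_absolutelyContinuous P _))
    (ae_quadTilt hB c d y)

lemma norm_integral_quadTilt_le [IsProbabilityMeasure P] (hP : ∀ᵐ x ∂P, ‖x‖ ≤ ρ) {f : Euc N → F}
    {B : ℝ} (hB : ∀ᵐ x ∂P, ‖f x‖ ≤ B) (c d : ℝ) (y : Euc N) :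
    ‖∫ x, f x ∂(quadTilt P c d y)‖ ≤ B := by
  have := isProbabilityMeasure_quadTilt hP c d y
  simpa using norm_integral_le_of_norm_le_const (ae_quadTilt hB c d y)

lemma norm_innerSL_smulRight_le {x : Euc N} {v : F} {B : ℝ} (hx : ‖x‖ ≤ ρ) (hv : ‖v‖ ≤ B) :
    ‖(innerSL ℝ x).smulRight v‖ ≤ ρ * B := by
  rw [ContinuousLinearMap.norm_smulRight_apply, innerSL_apply_norm]
  exact mul_le_mul hx hv (norm_nonneg v) ((norm_nonneg x).trans hx)

lemma continuous_innerSL_smulRight :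
    Continuous fun p : Euc N × F => (innerSL ℝ p.1).smulRight p.2 :=
  isBoundedBilinearMap_smulRight.continuous.comp
    (((innerSL ℝ).continuous.comp continuous_fst).prodMk continuous_snd)

omit [NormedSpace ℝ F] in
lemma aestronglyMeasurable_id_prodMk {f : Euc N → F} (hf : AEStronglyMeasurable f P) :
    AEStronglyMeasurable (fun x => (x, f x)) P :=
  (continuous_id.aestronglyMeasurable (α := Euc N)).prodMk hf

lemma aestronglyMeasurable_innerSL_smulRight {f : Euc N → F} (hf : AEStronglyMeasurable f P) :
    AEStronglyMeasurable (fun x => (innerSL ℝ x).smulRight (f x)) P := by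
  have := (continuous_innerSL_smulRight (F := F) (N := N)).comp_aestronglyMeasurable
    (aestronglyMeasurable_id_prodMk hf)
  exact this

lemma hasFDerivAt_integral_exp_quad_smul [IsProbabilityMeasure P] (hP : ∀ᵐ x ∂P, ‖x‖ ≤ ρ)
    {f : Euc N → F} (hf : AEStronglyMeasurable f P) {B : ℝ} (hB : ∀ᵐ x ∂P, ‖f x‖ ≤ B)
    (c d : ℝ) (y : Euc N) :
    HasFDerivAt (fun y => ∫ x, Real.exp (c * inner ℝ y x - d * ‖x‖ ^ 2) • f x ∂P)
      (c • ∫ x, Real.exp (c * inner ℝ y x - d * ‖x‖ ^ 2) • (innerSL ℝ x).smulRight (f x) ∂P) y := by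
  rw [← integral_smul]
  refine hasFDerivAt_integral_of_dominated_of_fderiv_le (s := Metric.ball y 1)
    (F' := fun y x => c • Real.exp (c * inner ℝ y x - d * ‖x‖ ^ 2) • (innerSL ℝ x).smulRight (f x))
    (bound := fun _ => |c| * (Real.exp (|c| * (‖y‖ + 1) * ρ + |d| * ρ ^ 2) * (ρ * B)))
    (Metric.ball_mem_nhds y one_pos)
    (Filter.Eventually.of_forall fun y => aestronglyMeasurable_exp_quad_smul hf c d y)
    (integrable_exp_quad_smul hP hf hB c d y)
    ((aestronglyMeasurable_exp_quad_smul
      (aestronglyMeasurable_innerSL_smulRight hf) c d y).const_smul c) ?_ (integrable_const _) ?_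
  · filter_upwards [hP, hB] with x hx hB y' hy'
    rw [norm_smul, Real.norm_eq_abs]
    refine mul_le_mul_of_nonneg_left ?_ (abs_nonneg c)
    refine norm_exp_smul_le le_rfl le_rfl ?_ hx (norm_innerSL_smulRight_le hx hB)
    have := norm_sub_norm_le y' y
    rw [Metric.mem_ball, dist_eq_norm] at hy'
    linarith
  · refine Filter.Eventually.of_forall fun x y' _ => ?_
    have h1 : HasFDerivAt (fun y : Euc N => c * inner ℝ y x - d * ‖x‖ ^ 2)
        (c • innerSL ℝ x) y' := by
      have h := (((innerSL ℝ x).hasFDerivAt (x := y')).const_mul c).sub_const (d * ‖x‖ ^ 2)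
      refine h.congr_of_eventuallyEq (Filter.Eventually.of_forall fun z => ?_)
      simp [real_inner_comm]
    refine (h1.exp.smul_const (f x)).congr_fderiv ?_
    ext v
    simp [smul_smul, mul_assoc, mul_left_comm]

/-- The derivative of a tilted mean in the tilting direction is a covariance. -/
lemma hasFDerivAt_integral_quadTilt [CompleteSpace F] [IsProbabilityMeasure P]
    (hP : ∀ᵐ x ∂P, ‖x‖ ≤ ρ)
    {f : Euc N → F} (hf : AEStronglyMeasurable f P) {B : ℝ} (hB : ∀ᵐ x ∂P, ‖f x‖ ≤ B)
    (c d : ℝ) (y : Euc N) :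
    HasFDerivAt (fun y => ∫ x, f x ∂(quadTilt P c d y))
      (c • (∫ x, (innerSL ℝ x).smulRight (f x) ∂(quadTilt P c d y) -
        (innerSL ℝ (∫ x, x ∂(quadTilt P c d y))).smulRight (∫ x, f x ∂(quadTilt P c d y)))) y := by
  have hZ := hasFDerivAt_integral_exp_quad_smul (f := fun _ => (1 : ℝ)) (B := 1) hP
    aestronglyMeasurable_const (by simp) c d y
  have hW := hasFDerivAt_integral_exp_quad_smul hP hf hB c d y
  simp only [smul_eq_mul, mul_one] at hZ
  have hZ0 := integral_exp_quad_pos hP c d y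
  simp_rw [integral_quadTilt f]
  have hm : innerSL ℝ (∫ x, x ∂(quadTilt P c d y)) =
      (∫ x, Real.exp (c * inner ℝ y x - d * ‖x‖ ^ 2) ∂P)⁻¹ •
        ∫ x, Real.exp (c * inner ℝ y x - d * ‖x‖ ^ 2) • (innerSL ℝ x).smulRight (1 : ℝ) ∂P := by
    rw [← integral_quadTilt, ← ContinuousLinearMap.integral_comp_comm (φ := fun x => x) (innerSL ℝ)
      (integrable_quadTilt hP (Measurable.aestronglyMeasurable measurable_id) hP c d y)]
    refine integral_congr_ae (Filter.Eventually.of_forall fun x => ?_)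
    ext v
    simp [innerSL_apply_apply ℝ]
  rw [hm, integral_quadTilt (fun x => (innerSL ℝ x).smulRight (f x))]
  refine (((hasDerivAt_inv hZ0.ne').comp_hasFDerivAt y hZ).smul hW).congr_fderiv ?_
  ext v
  simp only [add_apply, smul_apply,
    ContinuousLinearMap.smulRight_apply, Function.comp_apply, sub_apply, smul_eq_mul, smul_smul,
    smul_sub]
  module

end Tilt

/-! ### Regularity of the denoiser and of the velocity field -/

section TiltMean

variable {N : ℕ} {P : Measure (Euc N)} {ρ : ℝ} {F : Type*} [NormedAddCommGroup F] [NormedSpace ℝ F]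

lemma nonneg_of_ae_norm_le [IsProbabilityMeasure P] (hP : ∀ᵐ x ∂P, ‖x‖ ≤ ρ) : 0 ≤ ρ := by
  obtain ⟨x, hx⟩ := hP.exists
  exact (norm_nonneg x).trans hx

lemma norm_integral_quadTilt_sub_le [CompleteSpace F] [IsProbabilityMeasure P]
    (hP : ∀ᵐ x ∂P, ‖x‖ ≤ ρ) {f : Euc N → F} (hf : AEStronglyMeasurable f P) {B : ℝ}
    (hB : ∀ᵐ x ∂P, ‖f x‖ ≤ B) (c d : ℝ) (y y' : Euc N) :
    ‖∫ x, f x ∂(quadTilt P c d y') - ∫ x, f x ∂(quadTilt P c d y)‖ ≤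
      |c| * (2 * (ρ * B)) * ‖y' - y‖ := by
  have hprod : ∀ᵐ x ∂P, ‖(innerSL ℝ x).smulRight (f x)‖ ≤ ρ * B := by
    filter_upwards [hP, hB] with x hx hB using norm_innerSL_smulRight_le hx hB
  refine convex_univ.norm_image_sub_le_of_norm_hasFDerivWithin_le
    (fun z _ => (hasFDerivAt_integral_quadTilt hP hf hB c d z).hasFDerivWithinAt) (fun z _ => ?_)
    (mem_univ y) (mem_univ y')
  rw [norm_smul, Real.norm_eq_abs]
  refine mul_le_mul_of_nonneg_left ?_ (abs_nonneg c)
  refine (norm_sub_le _ _).trans ?_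
  have h1 := norm_integral_quadTilt_le hP hprod c d z
  have h2 := norm_innerSL_smulRight_le (norm_integral_quadTilt_le hP hP c d z)
    (norm_integral_quadTilt_le hP hB c d z)
  linarith

/-- The derivative of the tilted mean `y ↦ ∫ x ∂(quadTilt P c d y)`: the covariance matrix, up to
the factor `c`. -/
noncomputable def tiltCov (P : Measure (Euc N)) (c d : ℝ) (y : Euc N) : Euc N →L[ℝ] Euc N :=
  c • (∫ x, (innerSL ℝ x).smulRight x ∂(quadTilt P c d y) -
    (innerSL ℝ (∫ x, x ∂(quadTilt P c d y))).smulRight (∫ x, x ∂(quadTilt P c d y)))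

lemma aestronglyMeasurable_id_euc : AEStronglyMeasurable (fun x : Euc N => x) P :=
  continuous_id.aestronglyMeasurable

lemma hasFDerivAt_tiltMean [IsProbabilityMeasure P] (hP : ∀ᵐ x ∂P, ‖x‖ ≤ ρ) (c d : ℝ)
    (y : Euc N) :
    HasFDerivAt (fun y => ∫ x, x ∂(quadTilt P c d y)) (tiltCov P c d y) y :=
  hasFDerivAt_integral_quadTilt hP aestronglyMeasurable_id_euc hP c d y

lemma norm_tiltCov_le [IsProbabilityMeasure P] (hP : ∀ᵐ x ∂P, ‖x‖ ≤ ρ) (c d : ℝ) (y : Euc N) :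
    ‖tiltCov P c d y‖ ≤ |c| * (2 * ρ ^ 2) := by
  have hprod : ∀ᵐ x ∂P, ‖(innerSL ℝ x).smulRight x‖ ≤ ρ * ρ := by
    filter_upwards [hP] with x hx using norm_innerSL_smulRight_le hx hx
  rw [tiltCov, norm_smul, Real.norm_eq_abs]
  refine mul_le_mul_of_nonneg_left ?_ (abs_nonneg c)
  refine (norm_sub_le _ _).trans ?_
  have h1 := norm_integral_quadTilt_le hP hprod c d y
  have hm := norm_integral_quadTilt_le hP hP c d y
  have h2 := norm_innerSL_smulRight_le hm hm
  linarith

lemma norm_tiltCov_sub_le [IsProbabilityMeasure P] (hP : ∀ᵐ x ∂P, ‖x‖ ≤ ρ) (c d : ℝ)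
    (y y' : Euc N) :
    ‖tiltCov P c d y' - tiltCov P c d y‖ ≤ c ^ 2 * (6 * ρ ^ 3) * ‖y' - y‖ := by
  have hρ := nonneg_of_ae_norm_le hP
  have hprod : ∀ᵐ x ∂P, ‖(innerSL ℝ x).smulRight x‖ ≤ ρ * ρ := by
    filter_upwards [hP] with x hx using norm_innerSL_smulRight_le hx hx
  have h1 := norm_integral_quadTilt_sub_le hP
    (aestronglyMeasurable_innerSL_smulRight aestronglyMeasurable_id_euc) hprod c d y y'
  have hm := norm_integral_quadTilt_le hP hP c d y
  have hm' := norm_integral_quadTilt_le hP hP c d y'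
  have h2 := norm_integral_quadTilt_sub_le hP aestronglyMeasurable_id_euc hP c d y y'
  rw [tiltCov, tiltCov]
  set m := ∫ x, x ∂(quadTilt P c d y)
  set m' := ∫ x, x ∂(quadTilt P c d y')
  set A := ∫ x, (innerSL ℝ x).smulRight x ∂(quadTilt P c d y)
  set A' := ∫ x, (innerSL ℝ x).smulRight x ∂(quadTilt P c d y')
  have e : c • (A' - (innerSL ℝ m').smulRight m') - c • (A - (innerSL ℝ m).smulRight m) =
      c • ((A' - A) - ((innerSL ℝ m').smulRight (m' - m) + (innerSL ℝ (m' - m)).smulRight m)) := by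
    ext1 v
    simp only [map_sub, smul_apply, sub_apply, add_apply, ContinuousLinearMap.smulRight_apply]
    module
  have h3 : ‖(innerSL ℝ m').smulRight (m' - m)‖ ≤ ρ * (|c| * (2 * (ρ * ρ)) * ‖y' - y‖) :=
    norm_innerSL_smulRight_le hm' h2
  have h4 : ‖(innerSL ℝ (m' - m)).smulRight m‖ ≤ (|c| * (2 * (ρ * ρ)) * ‖y' - y‖) * ρ :=
    norm_innerSL_smulRight_le h2 hm
  rw [e, norm_smul, Real.norm_eq_abs]
  have h5 : ‖(A' - A) - ((innerSL ℝ m').smulRight (m' - m) + (innerSL ℝ (m' - m)).smulRight m)‖ ≤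
      |c| * (6 * ρ ^ 3) * ‖y' - y‖ := by
    refine (norm_sub_le _ _).trans ?_
    have := norm_add_le ((innerSL ℝ m').smulRight (m' - m)) ((innerSL ℝ (m' - m)).smulRight m)
    refine (add_le_add h1 (this.trans (add_le_add h3 h4))).trans (le_of_eq ?_)
    ring
  refine (mul_le_mul_of_nonneg_left h5 (abs_nonneg c)).trans (le_of_eq ?_)
  rw [← sq_abs c]
  ring

lemma continuous_integral_exp_quad_smul [IsFiniteMeasure P] (hP : ∀ᵐ x ∂P, ‖x‖ ≤ ρ) {f : Euc N → F}
    (hf : AEStronglyMeasurable f P) {B : ℝ} (hB : ∀ᵐ x ∂P, ‖f x‖ ≤ B) (y : Euc N) :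
    Continuous fun p : ℝ × ℝ => ∫ x, Real.exp (p.1 * inner ℝ y x - p.2 * ‖x‖ ^ 2) • f x ∂P := by
  refine continuous_iff_continuousAt.2 fun p => ?_
  refine continuousAt_of_dominated
    (bound := fun _ => Real.exp ((|p.1| + 1) * ‖y‖ * ρ + (|p.2| + 1) * ρ ^ 2) * B)
    (Filter.Eventually.of_forall fun q => aestronglyMeasurable_exp_quad_smul hf _ _ y) ?_
    (integrable_const _) ?_
  · filter_upwards [Metric.ball_mem_nhds p one_pos] with q hq
    rw [Metric.mem_ball, dist_eq_norm, Prod.norm_def, max_lt_iff] at hq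
    simp only [Prod.fst_sub, Prod.snd_sub, Real.norm_eq_abs] at hq
    filter_upwards [hP, hB] with x hx hB
    have h1 := abs_sub_abs_le_abs_sub q.1 p.1
    have h2 := abs_sub_abs_le_abs_sub q.2 p.2
    exact norm_exp_smul_le (by linarith) (by linarith) le_rfl hx hB
  · refine Filter.Eventually.of_forall fun x => Continuous.continuousAt ?_
    fun_prop

lemma continuous_tiltMean_param [IsProbabilityMeasure P] (hP : ∀ᵐ x ∂P, ‖x‖ ≤ ρ) (y : Euc N) :
    Continuous fun p : ℝ × ℝ => ∫ x, x ∂(quadTilt P p.1 p.2 y) := by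
  have h1 := continuous_integral_exp_quad_smul hP aestronglyMeasurable_id_euc hP y
  have h2 := continuous_integral_exp_quad_smul (f := fun _ => (1 : ℝ)) (B := 1) hP
    aestronglyMeasurable_const (by simp) y
  simp only [smul_eq_mul, mul_one] at h2
  simp_rw [integral_quadTilt]
  exact (h2.inv₀ fun p => (integral_exp_quad_pos hP p.1 p.2 y).ne').smul h1

end TiltMean

namespace IsInterpolant

variable {α β : ℝ → ℝ}

lemma continuousOn_timeDeriv_alpha (h : IsInterpolant α β) :
    ContinuousOn (timeDeriv α) (Icc 0 1) :=
  h.contDiff_alpha.continuousOn_derivWithin (uniqueDiffOn_Icc one_pos) le_rfl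

lemma continuousOn_timeDeriv_beta (h : IsInterpolant α β) :
    ContinuousOn (timeDeriv β) (Icc 0 1) :=
  h.contDiff_beta.continuousOn_derivWithin (uniqueDiffOn_Icc one_pos) le_rfl

end IsInterpolant

/-- The coefficient of `x̂₀` in `velocity = denoiserCoeff • x̂₀ + stateCoeff • y`. -/
noncomputable def denoiserCoeff (α β : ℝ → ℝ) (t : ℝ) : ℝ :=
  timeDeriv α t - timeDeriv β t * α t / β t

/-- The coefficient of `y` in `velocity = denoiserCoeff • x̂₀ + stateCoeff • y`. -/
noncomputable def stateCoeff (β : ℝ → ℝ) (t : ℝ) : ℝ := timeDeriv β t / β t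

section Velocity

variable {N : ℕ} {α β : ℝ → ℝ} {P₀ : Measure (Euc N)} {ρ : ℝ}

lemma integral_smul_add_const {E : Type*} [NormedAddCommGroup E] [NormedSpace ℝ E]
    [CompleteSpace E] [MeasurableSpace E] {μ : Measure E} [IsProbabilityMeasure μ]
    (hμ : Integrable (fun x => x) μ) (a : ℝ) (v : E) :
    ∫ x, (a • x + v) ∂μ = a • (∫ x, x ∂μ) + v := by
  have h : Integrable (fun x => a • x) μ := hμ.smul a
  have h2 : ∫ x, a • x ∂μ = a • ∫ x, x ∂μ := integral_smul a _
  rw [integral_add h (integrable_const v), integral_const, h2]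
  simp

lemma integrable_id_quadTilt [IsProbabilityMeasure P₀] (hP : ∀ᵐ x ∂P₀, ‖x‖ ≤ ρ) (c d : ℝ)
    (y : Euc N) : Integrable (fun x => x) (quadTilt P₀ c d y) :=
  integrable_quadTilt hP aestronglyMeasurable_id_euc hP c d y

lemma velocity_eq [IsProbabilityMeasure P₀] (hP : ∀ᵐ x ∂P₀, ‖x‖ ≤ ρ) (t : ℝ) (y : Euc N) :
    velocity α β P₀ t y =
      denoiserCoeff α β t • denoiser α β P₀ t y + stateCoeff β t • y := by
  have e : ∀ x : Euc N, timeDeriv α t • x + timeDeriv β t • ((β t)⁻¹ • (y - α t • x)) =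
      denoiserCoeff α β t • x + stateCoeff β t • y := by
    intro x
    rw [denoiserCoeff, stateCoeff, div_eq_mul_inv, div_eq_mul_inv]
    module
  have hprob : IsProbabilityMeasure (tiltedPosterior α β P₀ t y) :=
    isProbabilityMeasure_quadTilt hP _ _ y
  have hint : Integrable (fun x => x) (tiltedPosterior α β P₀ t y) :=
    integrable_id_quadTilt hP _ _ y
  rw [velocity, denoiser, funext e]
  exact integral_smul_add_const hint _ _

lemma algStep_eq [IsProbabilityMeasure P₀] (hP : ∀ᵐ x ∂P₀, ‖x‖ ≤ ρ) (δ t : ℝ) (y : Euc N) :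
    algStep α β P₀ δ t y = y - δ • velocity α β P₀ t y := by
  rw [algStep, velocity_eq hP, denoiserCoeff, stateCoeff]
  module

lemma norm_denoiser_le [IsProbabilityMeasure P₀] (hP : ∀ᵐ x ∂P₀, ‖x‖ ≤ ρ) (t : ℝ) (y : Euc N) :
    ‖denoiser α β P₀ t y‖ ≤ ρ :=
  norm_integral_quadTilt_le hP hP _ _ y

/-- The Jacobian of the denoiser in the space variable. -/
noncomputable def denoiserJac (α β : ℝ → ℝ) (P₀ : Measure (Euc N)) (t : ℝ) (y : Euc N) :
    Euc N →L[ℝ] Euc N :=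
  tiltCov P₀ (α t / β t ^ 2) (α t ^ 2 / (2 * β t ^ 2)) y

/-- The Jacobian of the velocity field in the space variable. -/
noncomputable def velocityJac (α β : ℝ → ℝ) (P₀ : Measure (Euc N)) (t : ℝ) (y : Euc N) :
    Euc N →L[ℝ] Euc N :=
  denoiserCoeff α β t • denoiserJac α β P₀ t y + stateCoeff β t • ContinuousLinearMap.id ℝ (Euc N)

lemma hasFDerivAt_denoiser [IsProbabilityMeasure P₀] (hP : ∀ᵐ x ∂P₀, ‖x‖ ≤ ρ) (t : ℝ)
    (y : Euc N) : HasFDerivAt (denoiser α β P₀ t) (denoiserJac α β P₀ t y) y :=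
  hasFDerivAt_tiltMean hP _ _ y

lemma continuous_denoiser [IsProbabilityMeasure P₀] (hP : ∀ᵐ x ∂P₀, ‖x‖ ≤ ρ) (t : ℝ) :
    Continuous (denoiser α β P₀ t) :=
  continuous_iff_continuousAt.2 fun y => (hasFDerivAt_denoiser hP t y).continuousAt

lemma hasFDerivAt_velocity [IsProbabilityMeasure P₀] (hP : ∀ᵐ x ∂P₀, ‖x‖ ≤ ρ) (t : ℝ)
    (y : Euc N) : HasFDerivAt (velocity α β P₀ t) (velocityJac α β P₀ t y) y := by
  rw [funext (velocity_eq hP t)]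
  exact ((hasFDerivAt_denoiser hP t y).const_smul (denoiserCoeff α β t)).add
    ((hasFDerivAt_id y).const_smul (stateCoeff β t))

lemma continuous_velocity [IsProbabilityMeasure P₀] (hP : ∀ᵐ x ∂P₀, ‖x‖ ≤ ρ) (t : ℝ) :
    Continuous (velocity α β P₀ t) :=
  continuous_iff_continuousAt.2 fun y => (hasFDerivAt_velocity hP t y).continuousAt

lemma continuousOn_denoiserCoeff (h : IsInterpolant α β) :
    ContinuousOn (denoiserCoeff α β) (Ioc 0 1) :=
  (h.continuousOn_timeDeriv_alpha.mono Ioc_subset_Icc_self).sub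
    (((h.continuousOn_timeDeriv_beta.mul h.contDiff_alpha.continuousOn).mono
      Ioc_subset_Icc_self).div (h.contDiff_beta.continuousOn.mono Ioc_subset_Icc_self)
      fun t ht => (h.beta_pos t ht).ne')

lemma continuousOn_stateCoeff (h : IsInterpolant α β) :
    ContinuousOn (stateCoeff β) (Ioc 0 1) :=
  (h.continuousOn_timeDeriv_beta.mono Ioc_subset_Icc_self).div
    (h.contDiff_beta.continuousOn.mono Ioc_subset_Icc_self) fun t ht => (h.beta_pos t ht).ne'

lemma continuousOn_tiltCoeff (h : IsInterpolant α β) :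
    ContinuousOn (fun t => α t / β t ^ 2) (Ioc 0 1) :=
  (h.contDiff_alpha.continuousOn.mono Ioc_subset_Icc_self).div
    ((h.contDiff_beta.continuousOn.mono Ioc_subset_Icc_self).pow 2)
    fun t ht => (pow_pos (h.beta_pos t ht) 2).ne'

lemma continuousOn_denoiser_time (h : IsInterpolant α β) [IsProbabilityMeasure P₀]
    (hP : ∀ᵐ x ∂P₀, ‖x‖ ≤ ρ) (y : Euc N) :
    ContinuousOn (fun t => denoiser α β P₀ t y) (Ioc 0 1) := by
  have hβ : ContinuousOn (fun t => 2 * β t ^ 2) (Ioc 0 1) :=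
    continuousOn_const.mul ((h.contDiff_beta.continuousOn.mono Ioc_subset_Icc_self).pow 2)
  have hd : ContinuousOn (fun t => α t ^ 2 / (2 * β t ^ 2)) (Ioc 0 1) :=
    ((h.contDiff_alpha.continuousOn.mono Ioc_subset_Icc_self).pow 2).div hβ
      fun t ht => (mul_pos two_pos (pow_pos (h.beta_pos t ht) 2)).ne'
  have hcd := (continuousOn_tiltCoeff h).prodMk hd
  have := (continuous_tiltMean_param hP y).comp_continuousOn hcd
  exact this

lemma continuousOn_velocity_time (h : IsInterpolant α β) [IsProbabilityMeasure P₀]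
    (hP : ∀ᵐ x ∂P₀, ‖x‖ ≤ ρ) (y : Euc N) :
    ContinuousOn (fun t => velocity α β P₀ t y) (Ioc 0 1) := by
  have h1 := (continuousOn_denoiserCoeff h).smul (continuousOn_denoiser_time h hP y)
  have h2 : ContinuousOn (fun t => stateCoeff β t • y) (Ioc 0 1) :=
    (continuousOn_stateCoeff h).smul continuousOn_const
  exact (h1.add h2).congr fun t _ => velocity_eq hP t y

lemma exists_coeff_bound (h : IsInterpolant α β) {T : ℝ} (hT : 0 < T) :
    ∃ C, 0 ≤ C ∧ ∀ t ∈ Icc T 1, |denoiserCoeff α β t| ≤ C ∧ |stateCoeff β t| ≤ C ∧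
      |α t / β t ^ 2| ≤ C := by
  have hsub : Icc T 1 ⊆ Ioc 0 1 := fun t ht => ⟨hT.trans_le ht.1, ht.2⟩
  obtain ⟨C₁, h₁⟩ := isCompact_Icc.exists_bound_of_continuousOn
    ((continuousOn_denoiserCoeff h).mono hsub)
  obtain ⟨C₂, h₂⟩ := isCompact_Icc.exists_bound_of_continuousOn
    ((continuousOn_stateCoeff h).mono hsub)
  obtain ⟨C₃, h₃⟩ := isCompact_Icc.exists_bound_of_continuousOn
    ((continuousOn_tiltCoeff h).mono hsub)
  refine ⟨max (max C₁ C₂) (max C₃ 0), by simp, fun t ht => ⟨(h₁ t ht).trans ?_,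
    (h₂ t ht).trans ?_, (h₃ t ht).trans ?_⟩⟩ <;> simp

lemma norm_velocity_le [IsProbabilityMeasure P₀] (hP : ∀ᵐ x ∂P₀, ‖x‖ ≤ ρ) {C t : ℝ}
    (h₁ : |denoiserCoeff α β t| ≤ C) (h₂ : |stateCoeff β t| ≤ C) (y : Euc N) :
    ‖velocity α β P₀ t y‖ ≤ C * (ρ + ‖y‖) := by
  rw [velocity_eq hP, mul_add]
  refine (norm_add_le _ _).trans (add_le_add ?_ ?_)
  · rw [norm_smul]
    exact mul_le_mul h₁ (norm_denoiser_le hP t y) (norm_nonneg _) ((abs_nonneg _).trans h₁)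
  · rw [norm_smul]
    exact mul_le_mul_of_nonneg_right h₂ (norm_nonneg _)

/-- Away from time `0` the velocity field is `C^{1,1}` in space, uniformly in time. The constant
depends on `P₀`; it only serves to identify limits, not to bound errors. -/
lemma exists_velocityJac_bound (h : IsInterpolant α β) [IsProbabilityMeasure P₀]
    (hP : ∀ᵐ x ∂P₀, ‖x‖ ≤ ρ) {T : ℝ} (hT : 0 < T) :
    ∃ C, 0 ≤ C ∧ ∀ t ∈ Icc T 1, (∀ y, ‖velocityJac α β P₀ t y‖ ≤ C) ∧
      (∀ y y', ‖velocityJac α β P₀ t y' - velocityJac α β P₀ t y‖ ≤ C * ‖y' - y‖) ∧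
      ∀ y, ‖velocity α β P₀ t y‖ ≤ C * (1 + ‖y‖) := by
  obtain ⟨C, hC0, hC⟩ := exists_coeff_bound h hT
  have hρ := nonneg_of_ae_norm_le hP
  refine ⟨C * (C * (2 * ρ ^ 2)) + C + C * (C ^ 2 * (6 * ρ ^ 3)) + C * ρ, by positivity,
    fun t ht => ⟨fun y => ?_, fun y y' => ?_, fun y => ?_⟩⟩
  · obtain ⟨h₁, h₂, h₃⟩ := hC t ht
    have e1 : ‖denoiserCoeff α β t • denoiserJac α β P₀ t y‖ ≤ C * (C * (2 * ρ ^ 2)) := by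
      rw [norm_smul]
      refine mul_le_mul h₁ ((norm_tiltCov_le hP _ _ y).trans ?_) (norm_nonneg _) hC0
      gcongr
    have e2 : ‖stateCoeff β t • ContinuousLinearMap.id ℝ (Euc N)‖ ≤ C * 1 := by
      rw [norm_smul]
      exact mul_le_mul h₂ ContinuousLinearMap.norm_id_le (norm_nonneg _) hC0
    have e3 : 0 ≤ C * (C ^ 2 * (6 * ρ ^ 3)) + C * ρ := by positivity
    refine (norm_add_le _ _).trans ((add_le_add e1 e2).trans ?_)
    linarith
  · obtain ⟨h₁, h₂, h₃⟩ := hC t ht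
    have e0 : velocityJac α β P₀ t y' - velocityJac α β P₀ t y =
        denoiserCoeff α β t • (denoiserJac α β P₀ t y' - denoiserJac α β P₀ t y) := by
      rw [velocityJac, velocityJac]
      module
    rw [e0, norm_smul]
    have e1 : ‖denoiserJac α β P₀ t y' - denoiserJac α β P₀ t y‖ ≤
        C ^ 2 * (6 * ρ ^ 3) * ‖y' - y‖ := by
      refine (norm_tiltCov_sub_le hP _ _ y y').trans ?_
      rw [← sq_abs]
      gcongr
    have e3 : 0 ≤ (C * (C * (2 * ρ ^ 2)) + C + C * ρ) * ‖y' - y‖ := by positivity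
    refine (mul_le_mul h₁ e1 (norm_nonneg _) hC0).trans ?_
    linarith
  · obtain ⟨h₁, h₂, h₃⟩ := hC t ht
    refine (norm_velocity_le hP h₁ h₂ y).trans ?_
    have e1 : 0 ≤ (C * (C * (2 * ρ ^ 2)) + C * (C ^ 2 * (6 * ρ ^ 3))) * (1 + ‖y‖) + C
      + C * ρ * ‖y‖ := by positivity
    linarith

end Velocity

/-! ### The denoiser as a conditional mean -/

section CondMean

variable {N : ℕ} {P : Measure (Euc N)} {ρ : ℝ} {F : Type*} [NormedAddCommGroup F] [NormedSpace ℝ F]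

lemma integral_clm_smul_eq_zero {E Ω : Type*} [NormedAddCommGroup E] [NormedSpace ℝ E]
    [CompleteSpace E] [CompleteSpace F] [MeasurableSpace Ω] {μ : Measure Ω} {w : Ω → ℝ} {v : Ω → E}
    (hint : Integrable (fun x => w x • v x) μ) (h0 : ∫ x, w x • v x ∂μ = 0) (A : E →L[ℝ] F) :
    ∫ x, w x • A (v x) ∂μ = 0 := by
  have := A.integral_comp_comm hint
  simp only [map_smul] at this
  rw [this, h0, map_zero]

lemma ae_fst_norm_le [SFinite P] (hP : ∀ᵐ x ∂P, ‖x‖ ≤ ρ) :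
    ∀ᵐ p ∂(P.prod (stdGaussian (Euc N))), ‖p.1‖ ≤ ρ :=
  Measure.quasiMeasurePreserving_fst.ae hP

lemma integrable_snd_of_stdGaussian [IsProbabilityMeasure P] {f : Euc N → ℝ}
    (hf : Integrable f (stdGaussian (Euc N))) :
    Integrable (fun p : Euc N × Euc N => f p.2) (P.prod (stdGaussian (Euc N))) :=
  hf.comp_snd P

lemma integrable_norm_snd_pow [IsProbabilityMeasure P] (k : ℕ) :
    Integrable (fun p : Euc N × Euc N => ‖p.2‖ ^ k) (P.prod (stdGaussian (Euc N))) :=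
  integrable_snd_of_stdGaussian (integrable_norm_pow_stdGaussian k)

/-- If `m y` is the mean of `quadTilt P (a / b²) (a² / (2 b²)) y`, then it is the conditional mean
of `x₀` given `a x₀ + b z = y`: the residual `x₀ - m` is orthogonal to every function of `y`. -/
lemma integral_clm_apply_sub_condMean [CompleteSpace F] [IsProbabilityMeasure P]
    (hP : ∀ᵐ x ∂P, ‖x‖ ≤ ρ) {a b : ℝ} (hb : 0 < b) {m : Euc N → Euc N} (hm : Continuous m)
    (hmρ : ∀ y, ‖m y‖ ≤ ρ)
    (hm0 : ∀ y, ∫ x, Real.exp (a / b ^ 2 * inner ℝ y x - a ^ 2 / (2 * b ^ 2) * ‖x‖ ^ 2) •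
      (x - m y) ∂P = 0)
    {G : Euc N → Euc N →L[ℝ] F} (hG : Continuous G) {C : ℝ} (hGC : ∀ y, ‖G y‖ ≤ C * (1 + ‖y‖)) :
    ∫ p, G (a • p.1 + b • p.2) (p.1 - m (a • p.1 + b • p.2)) ∂(P.prod (stdGaussian (Euc N))) =
      0 := by
  have hρ := nonneg_of_ae_norm_le hP
  have hC : 0 ≤ C := by
    have := (norm_nonneg _).trans (hGC 0)
    simpa using this
  have hbd : ∀ x y : Euc N, ‖x‖ ≤ ρ → ‖G y (x - m y)‖ ≤ C * (1 + ‖y‖) * (2 * ρ) := by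
    intro x y hx
    refine (ContinuousLinearMap.le_opNorm _ _).trans ?_
    refine mul_le_mul (hGC y) ?_ (norm_nonneg _) (by positivity)
    have := norm_sub_le x (m y)
    have := hmρ y
    linarith
  have hfib : ∀ x, Continuous fun y => G y (x - m y) := fun x =>
    hG.clm_apply (continuous_const.sub hm)
  have hlin : Continuous fun p : Euc N × Euc N => a • p.1 + b • p.2 := by fun_prop
  have hcont : Continuous fun p : Euc N × Euc N =>
      G (a • p.1 + b • p.2) (p.1 - m (a • p.1 + b • p.2)) :=
    (hG.comp hlin).clm_apply (continuous_fst.sub (hm.comp hlin))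
  have hsc : Continuous fun p : Euc N × Euc N => b • p.2 := by fun_prop
  have hcont2 : Continuous fun p : Euc N × Euc N =>
      Real.exp (a / b ^ 2 * inner ℝ (b • p.2) p.1 - a ^ 2 / (2 * b ^ 2) * ‖p.1‖ ^ 2) •
        G (b • p.2) (p.1 - m (b • p.2)) := by
    refine Continuous.smul (by fun_prop) ?_
    exact (hG.comp hsc).clm_apply (continuous_fst.sub (hm.comp hsc))
  have hint1 : Integrable (fun p : Euc N × Euc N =>
      G (a • p.1 + b • p.2) (p.1 - m (a • p.1 + b • p.2))) (P.prod (stdGaussian (Euc N))) := by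
    have hdom : Integrable (fun p : Euc N × Euc N => C * (1 + (|a| * ρ + b * ‖p.2‖ ^ 1)) * (2 * ρ))
        (P.prod (stdGaussian (Euc N))) :=
      (((integrable_const _).add ((integrable_const _).add
        ((integrable_norm_snd_pow 1).const_mul _))).const_mul _).mul_const _
    refine hdom.mono' hcont.aestronglyMeasurable ?_
    filter_upwards [ae_fst_norm_le hP] with p hp
    refine (hbd p.1 _ hp).trans ?_
    have : ‖a • p.1 + b • p.2‖ ≤ |a| * ρ + b * ‖p.2‖ ^ 1 := by
      refine (norm_add_le _ _).trans ?_
      rw [norm_smul, norm_smul, Real.norm_eq_abs, Real.norm_eq_abs, abs_of_pos hb, pow_one]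
      gcongr
    gcongr
  have hint2 : Integrable (fun p : Euc N × Euc N =>
      Real.exp (a / b ^ 2 * inner ℝ (b • p.2) p.1 - a ^ 2 / (2 * b ^ 2) * ‖p.1‖ ^ 2) •
        G (b • p.2) (p.1 - m (b • p.2))) (P.prod (stdGaussian (Euc N))) := by
    have hdom : Integrable (fun p : Euc N × Euc N =>
        Real.exp (|a ^ 2 / (2 * b ^ 2)| * ρ ^ 2) * (C * (2 * ρ)) *
          Real.exp ((|a / b ^ 2| * b * ρ + b) * ‖p.2‖)) (P.prod (stdGaussian (Euc N))) :=
      (integrable_snd_of_stdGaussian (integrable_exp_mul_norm_stdGaussian _)).const_mul _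
    refine hdom.mono' hcont2.aestronglyMeasurable ?_
    filter_upwards [ae_fst_norm_le hP] with p hp
    refine (norm_exp_smul_le le_rfl le_rfl le_rfl hp (hbd p.1 _ hp)).trans ?_
    rw [norm_smul, Real.norm_eq_abs, abs_of_pos hb]
    have h1 : 1 + b * ‖p.2‖ ≤ Real.exp (b * ‖p.2‖) := by
      rw [add_comm]; exact Real.add_one_le_exp _
    calc _ ≤ Real.exp (|a / b ^ 2| * (b * ‖p.2‖) * ρ + |a ^ 2 / (2 * b ^ 2)| * ρ ^ 2) *
          (C * Real.exp (b * ‖p.2‖) * (2 * ρ)) := by gcongr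
      _ = _ := by
        rw [add_mul, Real.exp_add, Real.exp_add,
          show |a / b ^ 2| * b * ρ * ‖p.2‖ = |a / b ^ 2| * (b * ‖p.2‖) * ρ by ring]
        ring
  -- for fixed `x₀ = x`, translating the noise by `(a / b) x` turns the law of `a x + b z` into that
  -- of `b z`, with exactly the weight that defines the tilt
  have hshift : ∀ x : Euc N, ∫ z, G (a • x + b • z) (x - m (a • x + b • z)) ∂(stdGaussian (Euc N)) =
      ∫ z, Real.exp (a / b ^ 2 * inner ℝ (b • z) x - a ^ 2 / (2 * b ^ 2) * ‖x‖ ^ 2) •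
        G (b • z) (x - m (b • z)) ∂(stdGaussian (Euc N)) := by
    intro x
    have hf : Continuous fun z : Euc N => G (b • z) (x - m (b • z)) :=
      (hfib x).comp (continuous_const_smul b)
    have key := integral_comp_const_add_stdGaussian ((a / b) • x) hf
    have e1 : ∀ z : Euc N, b • ((a / b) • x + z) = a • x + b • z := by
      intro z
      rw [smul_add, smul_smul, mul_div_cancel₀ _ hb.ne']
    simp only [e1] at key
    rw [key]
    refine integral_congr_ae (Filter.Eventually.of_forall fun z => ?_)
    have e2 : inner ℝ ((a / b) • x) z - ‖(a / b) • x‖ ^ 2 / 2 =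
        a / b ^ 2 * inner ℝ (b • z) x - a ^ 2 / (2 * b ^ 2) * ‖x‖ ^ 2 := by
      rw [real_inner_smul_left, real_inner_smul_left, norm_smul, mul_pow, Real.norm_eq_abs, sq_abs,
        real_inner_comm]
      field_simp
    simp only [e2]
  -- after the shift the integral over `x` comes first, at a fixed value `b z` of the observation
  rw [integral_prod _ hint1]
  simp_rw [hshift]
  rw [integral_integral_swap hint2]
  refine integral_eq_zero_of_ae (Filter.Eventually.of_forall fun z => ?_)
  have hv : ∀ᵐ x ∂P, ‖x - m (b • z)‖ ≤ 2 * ρ := by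
    filter_upwards [hP] with x hx
    have := norm_sub_le x (m (b • z))
    have := hmρ (b • z)
    linarith
  exact integral_clm_smul_eq_zero (integrable_exp_quad_smul hP
    (continuous_id.sub continuous_const).aestronglyMeasurable hv _ _ _) (hm0 (b • z)) (G (b • z))

lemma integral_exp_quad_smul_sub_tiltMean [IsProbabilityMeasure P] (hP : ∀ᵐ x ∂P, ‖x‖ ≤ ρ)
    (c d : ℝ) (y : Euc N) :
    ∫ x, Real.exp (c * inner ℝ y x - d * ‖x‖ ^ 2) • (x - ∫ x, x ∂(quadTilt P c d y)) ∂P = 0 := by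
  have hprob := isProbabilityMeasure_quadTilt hP c d y
  have h := integral_quadTilt (P := P) (fun x => x - ∫ x, x ∂(quadTilt P c d y)) c d y
  have h0 : ∫ x, (x - ∫ x, x ∂(quadTilt P c d y)) ∂(quadTilt P c d y) = 0 := by
    have := integral_smul_add_const (integrable_id_quadTilt hP c d y) 1
      (-∫ x, x ∂(quadTilt P c d y))
    simpa [sub_eq_add_neg] using this
  rw [h0] at h
  exact (smul_eq_zero.1 h.symm).resolve_left (inv_ne_zero (integral_exp_quad_pos hP c d y).ne')

/-- The residual of the denoiser is orthogonal to every function of the noisy observation. -/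
lemma integral_clm_apply_sub_denoiser [CompleteSpace F] [IsProbabilityMeasure P]
    (hP : ∀ᵐ x ∂P, ‖x‖ ≤ ρ) {α β : ℝ → ℝ} {t : ℝ} (hb : 0 < β t)
    {G : Euc N → Euc N →L[ℝ] F} (hG : Continuous G) {C : ℝ} (hGC : ∀ y, ‖G y‖ ≤ C * (1 + ‖y‖)) :
    ∫ p, G (α t • p.1 + β t • p.2) (p.1 - denoiser α β P t (α t • p.1 + β t • p.2))
      ∂(P.prod (stdGaussian (Euc N))) = 0 :=
  integral_clm_apply_sub_condMean hP hb (continuous_denoiser hP t) (norm_denoiser_le hP t)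
    (fun y => integral_exp_quad_smul_sub_tiltMean hP _ _ y) hG hGC

end CondMean

/-! ### Test functions and Euler steps -/

section Regularity

variable {E F : Type*} [NormedAddCommGroup E] [NormedSpace ℝ E] [NormedAddCommGroup F]
  [NormedSpace ℝ F]

/-- `u` is a test function with derivative `u'`, and `D` bounds `u`, `u'` and the Lipschitz
constant of `u'`. -/
structure HasC11Bound (D : ℝ) (u : E → F) (u' : E → E →L[ℝ] F) : Prop where
  hasFDerivAt : ∀ y, HasFDerivAt u (u' y) y
  norm_le : ∀ y, ‖u y‖ ≤ D
  norm_fderiv_le : ∀ y, ‖u' y‖ ≤ D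
  norm_fderiv_sub_le : ∀ y y', ‖u' y' - u' y‖ ≤ D * ‖y' - y‖

namespace HasC11Bound

variable {D : ℝ} {u : E → F} {u' : E → E →L[ℝ] F}

lemma nonneg (hu : HasC11Bound D u u') : 0 ≤ D := (norm_nonneg _).trans (hu.norm_le 0)

lemma continuous (hu : HasC11Bound D u u') : Continuous u :=
  continuous_iff_continuousAt.2 fun y => (hu.hasFDerivAt y).continuousAt

lemma continuous_fderiv (hu : HasC11Bound D u u') : Continuous u' :=
  (LipschitzWith.of_dist_le_mul (K := ⟨D, hu.nonneg⟩) fun y' y => by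
    rw [dist_eq_norm, dist_eq_norm]; exact hu.norm_fderiv_sub_le y y').continuous

lemma norm_taylor_le (hu : HasC11Bound D u u') (y v : E) :
    ‖u (y + v) - u y - u' y v‖ ≤ D * ‖v‖ ^ 2 := by
  have h := (convex_closedBall y ‖v‖).norm_image_sub_le_of_norm_hasFDerivWithin_le' (f := u)
    (f' := u') (φ := u' y) (C := D * ‖v‖) (x := y) (y := y + v)
    (fun z _ => (hu.hasFDerivAt z).hasFDerivWithinAt) (fun z hz => ?_)
    (Metric.mem_closedBall_self (norm_nonneg v)) (by simp)
  · rw [add_sub_cancel_left] at h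
    refine h.trans (le_of_eq (by ring))
  · refine (hu.norm_fderiv_sub_le y z).trans ?_
    rw [Metric.mem_closedBall, dist_eq_norm] at hz
    exact mul_le_mul_of_nonneg_left hz hu.nonneg

/-- Test functions are stable under composition with an Euler step, at the cost of a factor
`1 + O(h)`. -/
lemma comp_eulerStep (hu : HasC11Bound D u u') {b : E → E} {J : E → E →L[ℝ] E} {C h : ℝ}
    (hb : ∀ y, HasFDerivAt b (J y) y) (hJ : ∀ y, ‖J y‖ ≤ C)
    (hJ' : ∀ y y', ‖J y' - J y‖ ≤ C * ‖y' - y‖) (h0 : 0 ≤ h) (h1 : h ≤ 1) :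
    HasC11Bound (D * (1 + h * (3 * C + C ^ 2))) (fun y => u (y - h • b y))
      (fun y => (u' (y - h • b y)).comp (ContinuousLinearMap.id ℝ E - h • J y)) := by
  have hD := hu.nonneg
  have hC : 0 ≤ C := (norm_nonneg _).trans (hJ 0)
  have hS : ∀ y, HasFDerivAt (fun y => y - h • b y) (ContinuousLinearMap.id ℝ E - h • J y) y :=
    fun y => (hasFDerivAt_id y).sub ((hb y).const_smul h)
  have hA : ∀ y, ‖ContinuousLinearMap.id ℝ E - h • J y‖ ≤ 1 + h * C := by
    intro y
    refine (norm_sub_le _ _).trans (add_le_add ContinuousLinearMap.norm_id_le ?_)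
    rw [norm_smul, Real.norm_eq_abs, abs_of_nonneg h0]
    exact mul_le_mul_of_nonneg_left (hJ y) h0
  have hSL : ∀ y y', ‖(y' - h • b y') - (y - h • b y)‖ ≤ (1 + h * C) * ‖y' - y‖ := fun y y' =>
    convex_univ.norm_image_sub_le_of_norm_hasFDerivWithin_le
      (fun z _ => (hS z).hasFDerivWithinAt) (fun z _ => hA z) (mem_univ y) (mem_univ y')
  have hhC : 0 ≤ h * C := mul_nonneg h0 hC
  have hΛ : (1 + h * C) ^ 2 + h * C ≤ 1 + h * (3 * C + C ^ 2) := by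
    have : h ^ 2 * C ^ 2 ≤ h * C ^ 2 := by
      refine mul_le_mul_of_nonneg_right ?_ (sq_nonneg C)
      nlinarith
    nlinarith
  have hge : 1 + h * C ≤ 1 + h * (3 * C + C ^ 2) := by
    nlinarith [mul_nonneg h0 (sq_nonneg C)]
  refine ⟨fun y => (hu.hasFDerivAt _).comp y (hS y), fun y => ?_, fun y => ?_, fun y y' => ?_⟩
  · refine (hu.norm_le _).trans (le_mul_of_one_le_right hD ?_)
    linarith
  · refine (ContinuousLinearMap.opNorm_comp_le _ _).trans ?_
    exact (mul_le_mul (hu.norm_fderiv_le _) (hA y) (norm_nonneg _) hD).trans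
      (mul_le_mul_of_nonneg_left hge hD)
  · have e : (u' (y' - h • b y')).comp (ContinuousLinearMap.id ℝ E - h • J y') -
        (u' (y - h • b y)).comp (ContinuousLinearMap.id ℝ E - h • J y) =
        (u' (y' - h • b y') - u' (y - h • b y)).comp (ContinuousLinearMap.id ℝ E - h • J y') -
        (u' (y - h • b y)).comp (h • (J y' - J y)) := by
      ext v
      simp only [ContinuousLinearMap.comp_apply, sub_apply, smul_apply, map_sub, map_smul, smul_sub]
      abel
    have e1 : ‖(u' (y' - h • b y') - u' (y - h • b y)).comp
        (ContinuousLinearMap.id ℝ E - h • J y')‖ ≤ D * ((1 + h * C) * ‖y' - y‖) * (1 + h * C) := by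
      refine (ContinuousLinearMap.opNorm_comp_le _ _).trans ?_
      refine mul_le_mul ((hu.norm_fderiv_sub_le _ _).trans
        (mul_le_mul_of_nonneg_left (hSL y y') hD)) (hA y') (norm_nonneg _) (by positivity)
    have e2 : ‖(u' (y - h • b y)).comp (h • (J y' - J y))‖ ≤ D * (h * (C * ‖y' - y‖)) := by
      refine (ContinuousLinearMap.opNorm_comp_le _ _).trans ?_
      refine mul_le_mul (hu.norm_fderiv_le _) ?_ (norm_nonneg _) hD
      rw [norm_smul, Real.norm_eq_abs, abs_of_nonneg h0]
      exact mul_le_mul_of_nonneg_left (hJ' y y') h0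
    rw [e]
    refine (norm_sub_le _ _).trans ((add_le_add e1 e2).trans ?_)
    have := mul_le_mul_of_nonneg_right (mul_le_mul_of_nonneg_left hΛ hD) (norm_nonneg (y' - y))
    refine le_trans (le_of_eq ?_) this
    ring

end HasC11Bound

lemma one_add_mul_pow_le_exp {h L : ℝ} {l : ℕ} (h0 : 0 ≤ h) (hL : 0 ≤ L) (hl : l * h ≤ 1) :
    (1 + h * L) ^ l ≤ Real.exp L := by
  calc (1 + h * L) ^ l ≤ (Real.exp (h * L)) ^ l := by
        refine pow_le_pow_left₀ (by positivity) ?_ l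
        rw [add_comm]
        exact Real.add_one_le_exp _
    _ = Real.exp (l * h * L) := by rw [← Real.exp_nat_mul, mul_assoc]
    _ ≤ _ := Real.exp_le_exp.2 (mul_le_of_le_one_left hL hl)

/-- First-order Taylor expansion with a remainder that is uniform over the interval. -/
lemma exists_uniform_taylor {f : ℝ → ℝ} (hf : ContDiffOn ℝ 1 f (Icc 0 1)) {κ : ℝ} (hκ : 0 < κ) :
    ∃ h₀ > 0, ∀ t ∈ Icc (0 : ℝ) 1, ∀ s ∈ Icc (0 : ℝ) 1, |s - t| ≤ h₀ →
      |f s - f t - (s - t) * timeDeriv f t| ≤ κ * |s - t| := by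
  have hc : ContinuousOn (timeDeriv f) (Icc 0 1) :=
    hf.continuousOn_derivWithin (uniqueDiffOn_Icc one_pos) le_rfl
  have huc := isCompact_Icc.uniformContinuousOn_of_continuous hc
  obtain ⟨h₀, hh₀, H⟩ := Metric.uniformContinuousOn_iff.1 huc κ hκ
  refine ⟨h₀ / 2, half_pos hh₀, fun t ht s hs hst => ?_⟩
  have hsub : uIcc t s ⊆ Icc 0 1 := uIcc_subset_Icc ht hs
  have hd : ∀ x ∈ uIcc t s, HasDerivWithinAt (fun x => f x - x * timeDeriv f t)
      (timeDeriv f x - 1 * timeDeriv f t) (uIcc t s) x := by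
    intro x hx
    have h1 : HasDerivWithinAt f (timeDeriv f x) (Icc 0 1) x :=
      (hf.differentiableOn (by norm_num) x (hsub hx)).hasDerivWithinAt
    exact (h1.mono hsub).sub ((hasDerivWithinAt_id x _).mul_const _)
  have h := (convex_uIcc t s).norm_image_sub_le_of_norm_hasDerivWithin_le (C := κ) hd
    (fun x hx => ?_) left_mem_uIcc right_mem_uIcc
  · rw [Real.norm_eq_abs, Real.norm_eq_abs] at h
    refine le_trans (le_of_eq ?_) h
    congr 1
    ring
  · have hxt : |x - t| ≤ |s - t| := abs_sub_left_of_mem_uIcc hx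
    have := H x (hsub hx) t ht (by rw [Real.dist_eq]; linarith)
    rw [Real.dist_eq] at this
    rw [Real.norm_eq_abs, one_mul]
    exact this.le

end Regularity

/-! ### Weak convergence of the Euler scheme -/

section WeakError

variable {N : ℕ} {α β : ℝ → ℝ} {P₀ : Measure (Euc N)} {ρ : ℝ} {F : Type*} [NormedAddCommGroup F]
  [NormedSpace ℝ F]

/-- The interpolant `y(t)` as a function of the pair `(x₀, z)`. -/
noncomputable def noisyState (α β : ℝ → ℝ) (t : ℝ) (p : Euc N × Euc N) : Euc N :=
  α t • p.1 + β t • p.2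

lemma continuous_noisyState (t : ℝ) : Continuous (noisyState (N := N) α β t) := by
  unfold noisyState
  fun_prop

lemma continuous_algState [IsProbabilityMeasure P₀] (hP : ∀ᵐ x ∂P₀, ‖x‖ ≤ ρ) (δ : ℝ) (l : ℕ) :
    Continuous (algState α β P₀ δ l) := by
  induction l with
  | zero => exact continuous_id
  | succ l ih =>
    have h := (continuous_id.sub ((continuous_velocity (α := α) (β := β) hP
      (1 - l * δ)).const_smul δ)).comp ih
    refine h.congr fun z => ?_
    rw [algState, algStep_eq hP]
    rfl

/-- The noise velocity minus the averaged velocity is a multiple of the denoiser's residual. -/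
lemma deriv_noisyState_sub_velocity [IsProbabilityMeasure P₀] (hP : ∀ᵐ x ∂P₀, ‖x‖ ≤ ρ) {t : ℝ}
    (hb : 0 < β t) (p : Euc N × Euc N) :
    timeDeriv α t • p.1 + timeDeriv β t • p.2 - velocity α β P₀ t (noisyState α β t p) =
      denoiserCoeff α β t • (p.1 - denoiser α β P₀ t (noisyState α β t p)) := by
  rw [velocity_eq hP, denoiserCoeff, stateCoeff]
  generalize denoiser α β P₀ t (noisyState α β t p) = m
  rw [noisyState]
  have e : timeDeriv β t • p.2 = (timeDeriv β t / β t) • (β t • p.2) := by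
    rw [smul_smul, div_mul_cancel₀ _ hb.ne']
  rw [e]
  module

/-- The one-step consistency error, before taking expectations. -/
lemma norm_weakStep_le {D C C₁ κ h t s : ℝ} {u : Euc N → F} {u' : Euc N → Euc N →L[ℝ] F}
    (hu : HasC11Bound D u u') [IsProbabilityMeasure P₀] (hP : ∀ᵐ x ∂P₀, ‖x‖ ≤ ρ) (hb : 0 < β t)
    (hs : s = t - h) (h0 : 0 ≤ h) (hκ0 : 0 ≤ κ) (hκ : κ ≤ 1)
    (hα : |α s - α t - (s - t) * timeDeriv α t| ≤ κ * h)
    (hβ : |β s - β t - (s - t) * timeDeriv β t| ≤ κ * h)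
    (hC₁ : |α t| ≤ C₁ ∧ |β t| ≤ C₁ ∧ |timeDeriv α t| ≤ C₁ ∧ |timeDeriv β t| ≤ C₁)
    (hC0 : 0 ≤ C) (hC : ∀ y, ‖velocity α β P₀ t y‖ ≤ C * (1 + ‖y‖)) {p : Euc N × Euc N}
    (hp : ‖p.1‖ ≤ ρ) :
    ‖u (noisyState α β s p) -
        u (noisyState α β t p - h • velocity α β P₀ t (noisyState α β t p)) +
        (h * denoiserCoeff α β t) •
          u' (noisyState α β t p) (p.1 - denoiser α β P₀ t (noisyState α β t p))‖ ≤
      D * h * (κ + h) * (((1 + C₁) ^ 2 + 1 + (C * (1 + C₁)) ^ 2) * (1 + ρ + ‖p.2‖) ^ 2) := by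
  obtain ⟨hα1, hβ1, hα2, hβ2⟩ := hC₁
  have hC₁0 : 0 ≤ C₁ := (abs_nonneg _).trans hα1
  have hD := hu.nonneg
  have hρ : 0 ≤ ρ := (norm_nonneg _).trans hp
  set y := noisyState α β t p with hy
  set b := velocity α β P₀ t y with hbdef
  set r := 1 + ρ + ‖p.2‖ with hr
  have hz0 := norm_nonneg p.2
  have hr1 : 1 ≤ r := by linarith
  -- the exact increment of the interpolant, and its deviation from the linear one
  set Δ := noisyState α β s p - y with hΔ
  set E := Δ + h • (timeDeriv α t • p.1 + timeDeriv β t • p.2) with hE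
  have eE : E = (α s - α t - (s - t) * timeDeriv α t) • p.1 +
      (β s - β t - (s - t) * timeDeriv β t) • p.2 := by
    rw [hE, hΔ, hy, noisyState, noisyState, hs]
    module
  have nE : ‖E‖ ≤ κ * h * r := by
    rw [eE]
    refine (norm_add_le _ _).trans ?_
    rw [norm_smul, norm_smul, Real.norm_eq_abs, Real.norm_eq_abs]
    have h1 := mul_le_mul hα hp (norm_nonneg _) (by positivity)
    have h2 := mul_le_mul_of_nonneg_right hβ hz0
    have h3 : 0 ≤ κ * h := by positivity
    rw [hr]
    linarith
  have nV : ‖timeDeriv α t • p.1 + timeDeriv β t • p.2‖ ≤ C₁ * r := by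
    refine (norm_add_le _ _).trans ?_
    rw [norm_smul, norm_smul, Real.norm_eq_abs, Real.norm_eq_abs]
    have h1 := mul_le_mul hα2 hp (norm_nonneg _) hC₁0
    have h2 := mul_le_mul_of_nonneg_right hβ2 hz0
    rw [hr]
    linarith
  have nΔ : ‖Δ‖ ≤ h * ((1 + C₁) * r) := by
    have e : Δ = E - h • (timeDeriv α t • p.1 + timeDeriv β t • p.2) := by rw [hE]; abel
    rw [e]
    refine (norm_sub_le _ _).trans ?_
    rw [norm_smul, Real.norm_eq_abs, abs_of_nonneg h0]
    have h1 := mul_le_mul_of_nonneg_left nV h0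
    have h2 : κ * h * r ≤ 1 * h * r := by gcongr
    linarith
  have ny : ‖y‖ ≤ C₁ * r := by
    rw [hy, noisyState]
    refine (norm_add_le _ _).trans ?_
    rw [norm_smul, norm_smul, Real.norm_eq_abs, Real.norm_eq_abs]
    have h1 := mul_le_mul hα1 hp (norm_nonneg _) hC₁0
    have h2 := mul_le_mul_of_nonneg_right hβ1 hz0
    rw [hr]
    linarith
  have nb : ‖h • b‖ ≤ h * (C * (1 + C₁) * r) := by
    rw [norm_smul, Real.norm_eq_abs, abs_of_nonneg h0]
    refine mul_le_mul_of_nonneg_left ((hC y).trans ?_) h0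
    rw [mul_assoc]
    refine mul_le_mul_of_nonneg_left ?_ hC0
    linarith
  have t1 := hu.norm_taylor_le y Δ
  have t2 := hu.norm_taylor_le y (-(h • b))
  have t3 : ‖u' y E‖ ≤ D * (κ * h * r) :=
    (ContinuousLinearMap.le_opNorm _ _).trans
      (mul_le_mul (hu.norm_fderiv_le y) nE (norm_nonneg _) hD)
  have e1 : y + Δ = noisyState α β s p := by rw [hΔ]; abel
  have key := deriv_noisyState_sub_velocity (α := α) hP hb p
  rw [← hy, ← hbdef] at key
  rw [e1] at t1
  rw [norm_neg, ← sub_eq_add_neg] at t2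
  have e2 : u (noisyState α β s p) - u (y - h • b) +
      (h * denoiserCoeff α β t) • u' y (p.1 - denoiser α β P₀ t y) =
      (u (noisyState α β s p) - u y - u' y Δ) - (u (y - h • b) - u y - u' y (-(h • b))) +
        u' y E := by
    rw [mul_smul, ← map_smul, ← key, ← map_smul, hE]
    simp only [map_add, map_sub, map_smul, map_neg, smul_sub, smul_add]
    abel
  rw [e2]
  refine (norm_add_le _ _).trans
    ((add_le_add ((norm_sub_le _ _).trans (add_le_add t1 t2)) t3).trans ?_)
  have s1 : ‖Δ‖ ^ 2 ≤ (h * ((1 + C₁) * r)) ^ 2 := by gcongr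
  have s2 : ‖h • b‖ ^ 2 ≤ (h * (C * (1 + C₁) * r)) ^ 2 := by gcongr
  have s3 : r ≤ r ^ 2 := by nlinarith
  have q : ‖Δ‖ ^ 2 + ‖h • b‖ ^ 2 + κ * h * r ≤
      h * (κ + h) * (((1 + C₁) ^ 2 + 1 + (C * (1 + C₁)) ^ 2) * r ^ 2) := by
    have s4 : κ * h * r ≤ κ * h * r ^ 2 := by gcongr
    have s5 : 0 ≤ h * κ * (((1 + C₁) ^ 2 + (C * (1 + C₁)) ^ 2) * r ^ 2) + h ^ 2 * r ^ 2 := by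
      positivity
    calc _ ≤ (h * ((1 + C₁) * r)) ^ 2 + (h * (C * (1 + C₁) * r)) ^ 2 + κ * h * r ^ 2 := by
          linarith
      _ ≤ _ := by
          refine le_trans (le_add_of_nonneg_right s5) (le_of_eq ?_)
          ring
  calc _ = D * (‖Δ‖ ^ 2 + ‖h • b‖ ^ 2 + κ * h * r) := by ring
    _ ≤ D * (h * (κ + h) * (((1 + C₁) ^ 2 + 1 + (C * (1 + C₁)) ^ 2) * r ^ 2)) :=
        mul_le_mul_of_nonneg_left q hD
    _ = _ := by ring

/-- The part of the weak error bound that is a function of the noise alone. -/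
noncomputable def weakWeight (N : ℕ) (ρ C C₁ : ℝ) : ℝ :=
  ∫ z : Euc N, ((1 + C₁) ^ 2 + 1 + (C * (1 + C₁)) ^ 2) * (1 + ρ + ‖z‖) ^ 2 ∂(stdGaussian (Euc N))

lemma integrable_weakWeight (N : ℕ) (ρ C C₁ : ℝ) :
    Integrable (fun z : Euc N => ((1 + C₁) ^ 2 + 1 + (C * (1 + C₁)) ^ 2) * (1 + ρ + ‖z‖) ^ 2)
      (stdGaussian (Euc N)) := by
  have h : Integrable (fun z : Euc N => (1 + ρ) ^ 2 + 2 * (1 + ρ) * ‖z‖ ^ 1 + ‖z‖ ^ 2)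
      (stdGaussian (Euc N)) :=
    ((integrable_const _).add ((integrable_norm_pow_stdGaussian 1).const_mul _)).add
      (integrable_norm_pow_stdGaussian 2)
  refine (h.const_mul ((1 + C₁) ^ 2 + 1 + (C * (1 + C₁)) ^ 2)).congr
    (Filter.Eventually.of_forall fun z => ?_)
  simp only
  ring

lemma weakWeight_nonneg (N : ℕ) (ρ C C₁ : ℝ) : 0 ≤ weakWeight N ρ C C₁ :=
  integral_nonneg fun z => by positivity

/-- Replacing one exact transition of the interpolant by an Euler step changes expectations by
`o(h)`: to first order the step acts on `u` through the conditional mean of the velocity. -/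
lemma norm_integral_weakStep_le [CompleteSpace F] {D C C₁ κ h t s : ℝ} {u : Euc N → F}
    {u' : Euc N → Euc N →L[ℝ] F} (hu : HasC11Bound D u u') [IsProbabilityMeasure P₀]
    (hP : ∀ᵐ x ∂P₀, ‖x‖ ≤ ρ) (hb : 0 < β t)
    (hs : s = t - h) (h0 : 0 ≤ h) (hκ0 : 0 ≤ κ) (hκ : κ ≤ 1)
    (hα : |α s - α t - (s - t) * timeDeriv α t| ≤ κ * h)
    (hβ : |β s - β t - (s - t) * timeDeriv β t| ≤ κ * h)
    (hC₁ : |α t| ≤ C₁ ∧ |β t| ≤ C₁ ∧ |timeDeriv α t| ≤ C₁ ∧ |timeDeriv β t| ≤ C₁)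
    (hC0 : 0 ≤ C) (hC : ∀ y, ‖velocity α β P₀ t y‖ ≤ C * (1 + ‖y‖)) :
    ‖∫ p, u (noisyState α β s p) ∂(P₀.prod (stdGaussian (Euc N))) -
      ∫ p, u (noisyState α β t p - h • velocity α β P₀ t (noisyState α β t p))
        ∂(P₀.prod (stdGaussian (Euc N)))‖ ≤ D * h * (κ + h) * weakWeight N ρ C C₁ := by
  set μ := P₀.prod (stdGaussian (Euc N)) with hμ
  have hbdd : ∀ {S : Euc N × Euc N → Euc N}, Continuous S → Integrable (fun p => u (S p)) μ :=
    fun hS => (integrable_const D).mono' (hu.continuous.comp hS).aestronglyMeasurable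
      (Filter.Eventually.of_forall fun p => hu.norm_le _)
  have hy := continuous_noisyState (N := N) (α := α) (β := β) t
  have i1 := hbdd (continuous_noisyState (N := N) (α := α) (β := β) s)
  have i2 : Integrable (fun p : Euc N × Euc N =>
      u (noisyState α β t p - h • velocity α β P₀ t (noisyState α β t p))) μ :=
    hbdd (hy.sub (((continuous_velocity (α := α) (β := β) hP t).comp hy).const_smul h))
  have i3 : Integrable (fun p : Euc N × Euc N => (h * denoiserCoeff α β t) •
      u' (noisyState α β t p) (p.1 - denoiser α β P₀ t (noisyState α β t p))) μ := by
    refine (integrable_const (|h * denoiserCoeff α β t| * (D * (2 * ρ)))).mono' ?_ ?_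
    · exact (((hu.continuous_fderiv.comp hy).clm_apply
        (continuous_fst.sub ((continuous_denoiser hP t).comp hy))).const_smul
          (h * denoiserCoeff α β t)).aestronglyMeasurable
    · filter_upwards [ae_fst_norm_le hP] with p hp
      rw [norm_smul, Real.norm_eq_abs]
      refine mul_le_mul_of_nonneg_left ?_ (abs_nonneg _)
      refine (ContinuousLinearMap.le_opNorm _ _).trans
        (mul_le_mul (hu.norm_fderiv_le _) ?_ (norm_nonneg _) hu.nonneg)
      refine (norm_sub_le _ _).trans ?_
      have := norm_denoiser_le (α := α) (β := β) hP t (noisyState α β t p)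
      linarith
  -- the first-order term has mean zero, since the residual is orthogonal to functions of `y(t)`
  have i4 : ∫ p, (h * denoiserCoeff α β t) •
      u' (noisyState α β t p) (p.1 - denoiser α β P₀ t (noisyState α β t p)) ∂μ = 0 := by
    have h4 := integral_clm_apply_sub_denoiser (α := α) hP hb hu.continuous_fderiv (C := D)
      fun y => (hu.norm_fderiv_le y).trans
        (le_mul_of_one_le_right hu.nonneg (by linarith [norm_nonneg y]))
    have h5 : ∫ p, (h * denoiserCoeff α β t) •
        u' (noisyState α β t p) (p.1 - denoiser α β P₀ t (noisyState α β t p)) ∂μ =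
        (h * denoiserCoeff α β t) • ∫ p,
        u' (noisyState α β t p) (p.1 - denoiser α β P₀ t (noisyState α β t p)) ∂μ :=
      integral_smul _ _
    rw [h5, hμ]
    unfold noisyState
    rw [h4, smul_zero]
  have e : ∫ p, u (noisyState α β s p) ∂μ -
      ∫ p, u (noisyState α β t p - h • velocity α β P₀ t (noisyState α β t p)) ∂μ =
      ∫ p, (u (noisyState α β s p) -
        u (noisyState α β t p - h • velocity α β P₀ t (noisyState α β t p)) +
        (h * denoiserCoeff α β t) • u' (noisyState α β t p)
          (p.1 - denoiser α β P₀ t (noisyState α β t p))) ∂μ := by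
    have i12 : Integrable (fun p : Euc N × Euc N => u (noisyState α β s p) -
      u (noisyState α β t p - h • velocity α β P₀ t (noisyState α β t p))) μ := i1.sub i2
    rw [integral_add i12 i3, integral_sub i1 i2, i4, add_zero]
  rw [e]
  have hW := integrable_snd_of_stdGaussian (P := P₀) (integrable_weakWeight N ρ C C₁)
  have hWi : ∫ p, ((1 + C₁) ^ 2 + 1 + (C * (1 + C₁)) ^ 2) * (1 + ρ + ‖p.2‖) ^ 2 ∂μ =
      weakWeight N ρ C C₁ := by
    rw [weakWeight, hμ]
    have := integral_fun_snd (μ := P₀) (ν := stdGaussian (Euc N))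
      (fun z : Euc N => ((1 + C₁) ^ 2 + 1 + (C * (1 + C₁)) ^ 2) * (1 + ρ + ‖z‖) ^ 2)
    simpa using this
  rw [← hWi, ← integral_const_mul]
  refine norm_integral_le_of_norm_le (hW.const_mul _) ?_
  filter_upwards [ae_fst_norm_le hP] with p hp
  exact norm_weakStep_le hu hP hb hs h0 hκ0 hκ hα hβ hC₁ hC0 hC hp

/-- The weak error of the Euler scheme after `l` steps, uniformly over test functions. Each Euler
step is absorbed into the test function, which stays in the class `HasC11Bound`. -/
lemma norm_weakError_le [CompleteSpace F] (hI : IsInterpolant α β) [IsProbabilityMeasure P₀]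
    (hP : ∀ᵐ x ∂P₀, ‖x‖ ≤ ρ) {T C C₁ κ h : ℝ} (hT : 0 < T) (h0 : 0 ≤ h) (h1 : h ≤ 1)
    (hκ0 : 0 ≤ κ) (hκ : κ ≤ 1)
    (hα : ∀ t ∈ Icc (0 : ℝ) 1, ∀ s ∈ Icc (0 : ℝ) 1, |s - t| ≤ h →
      |α s - α t - (s - t) * timeDeriv α t| ≤ κ * |s - t|)
    (hβ : ∀ t ∈ Icc (0 : ℝ) 1, ∀ s ∈ Icc (0 : ℝ) 1, |s - t| ≤ h →
      |β s - β t - (s - t) * timeDeriv β t| ≤ κ * |s - t|)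
    (hC₁ : ∀ t ∈ Icc T 1, |α t| ≤ C₁ ∧ |β t| ≤ C₁ ∧ |timeDeriv α t| ≤ C₁ ∧ |timeDeriv β t| ≤ C₁)
    (hC0 : 0 ≤ C)
    (hC : ∀ t ∈ Icc T 1, (∀ y, ‖velocityJac α β P₀ t y‖ ≤ C) ∧
      (∀ y y', ‖velocityJac α β P₀ t y' - velocityJac α β P₀ t y‖ ≤ C * ‖y' - y‖) ∧
      ∀ y, ‖velocity α β P₀ t y‖ ≤ C * (1 + ‖y‖)) (l : ℕ) (hl : l * h ≤ 1 - T) :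
    ∀ {D : ℝ} {u : Euc N → F} {u' : Euc N → Euc N →L[ℝ] F}, HasC11Bound D u u' →
    ‖∫ p, u (noisyState α β (1 - l * h) p) ∂(P₀.prod (stdGaussian (Euc N))) -
      ∫ z, u (algState α β P₀ h l z) ∂(stdGaussian (Euc N))‖ ≤
      l * h * (κ + h) * weakWeight N ρ C C₁ * (D * (1 + h * (3 * C + C ^ 2)) ^ l) := by
  induction l with
  | zero =>
    intro D u u' hu
    have e := integral_fun_snd (μ := P₀) (ν := stdGaussian (Euc N)) u
    simp only [probReal_univ, one_smul] at e
    simp [noisyState, hI.alpha_one, hI.beta_one, algState, e]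
  | succ l ih =>
    intro D u u' hu
    push_cast at hl
    have hl' : l * h ≤ 1 - T := by linarith
    have hlh : 0 ≤ l * h := by positivity
    have hW := weakWeight_nonneg N ρ C C₁
    have hD := hu.nonneg
    set t := 1 - l * h with ht
    have htT : t ∈ Icc T 1 := ⟨by linarith, by linarith⟩
    have ht01 : t ∈ Icc (0 : ℝ) 1 := ⟨by linarith [htT.1], htT.2⟩
    have hs : 1 - (l + 1 : ℕ) * h = t - h := by push_cast; linarith
    have hs01 : t - h ∈ Icc (0 : ℝ) 1 := ⟨by linarith, by linarith [htT.2]⟩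
    have habs : |t - h - t| = h := by rw [sub_sub_cancel_left, abs_neg, abs_of_nonneg h0]
    obtain ⟨hJ, hJ', hv⟩ := hC t htT
    have hstep := norm_integral_weakStep_le (P₀ := P₀) (s := t - h) hu hP
      (hI.beta_pos t ⟨by linarith [htT.1], htT.2⟩) rfl h0 hκ0 hκ
      (by simpa only [habs] using hα t ht01 (t - h) hs01 habs.le)
      (by simpa only [habs] using hβ t ht01 (t - h) hs01 habs.le) (hC₁ t htT) hC0 hv
    -- the last Euler step is moved into the test function
    have hind := ih hl' (hu.comp_eulerStep (fun y => hasFDerivAt_velocity hP t y) hJ hJ' h0 h1)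
    have ealg : ∀ z, algState α β P₀ h (l + 1) z =
        algState α β P₀ h l z - h • velocity α β P₀ t (algState α β P₀ h l z) := fun z => by
      rw [algState, algStep_eq hP]
    rw [hs]
    simp_rw [ealg]
    refine (norm_sub_le_norm_sub_add_norm_sub _ (∫ p, u (noisyState α β t p -
      h • velocity α β P₀ t (noisyState α β t p)) ∂(P₀.prod (stdGaussian (Euc N)))) _).trans ?_
    refine (add_le_add hstep hind).trans ?_
    set q := 1 + h * (3 * C + C ^ 2) with hq
    have hq1 : 1 ≤ q := by
      have : 0 ≤ h * (3 * C + C ^ 2) := by positivity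
      linarith
    have hpow : D * h * (κ + h) * weakWeight N ρ C C₁ * 1 ≤
        D * h * (κ + h) * weakWeight N ρ C C₁ * q ^ (l + 1) :=
      mul_le_mul_of_nonneg_left (one_le_pow₀ hq1) (by positivity)
    push_cast
    calc _ ≤ D * h * (κ + h) * weakWeight N ρ C C₁ * q ^ (l + 1) +
        l * h * (κ + h) * weakWeight N ρ C C₁ * (D * q * q ^ l) := by linarith
      _ = _ := by ring

lemma exists_interpolant_bound (hI : IsInterpolant α β) :
    ∃ C₁, ∀ t ∈ Icc (0 : ℝ) 1,
      |α t| ≤ C₁ ∧ |β t| ≤ C₁ ∧ |timeDeriv α t| ≤ C₁ ∧ |timeDeriv β t| ≤ C₁ := by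
  obtain ⟨a, ha⟩ := isCompact_Icc.exists_bound_of_continuousOn hI.contDiff_alpha.continuousOn
  obtain ⟨b, hb⟩ := isCompact_Icc.exists_bound_of_continuousOn hI.contDiff_beta.continuousOn
  obtain ⟨c, hc⟩ := isCompact_Icc.exists_bound_of_continuousOn hI.continuousOn_timeDeriv_alpha
  obtain ⟨d, hd⟩ := isCompact_Icc.exists_bound_of_continuousOn hI.continuousOn_timeDeriv_beta
  refine ⟨max (max a b) (max c d), fun t ht => ⟨(ha t ht).trans ?_, (hb t ht).trans ?_,
    (hc t ht).trans ?_, (hd t ht).trans ?_⟩⟩ <;> simp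

/-- The Euler scheme converges weakly to the law of the interpolant as the step tends to zero. -/
lemma exists_weakError_lt [CompleteSpace F] (hI : IsInterpolant α β) [IsProbabilityMeasure P₀]
    (hP : ∀ᵐ x ∂P₀, ‖x‖ ≤ ρ) {T : ℝ} (hT : 0 < T) {D : ℝ} {u : Euc N → F}
    {u' : Euc N → Euc N →L[ℝ] F} (hu : HasC11Bound D u u') {e : ℝ} (he : 0 < e) :
    ∃ h₀ > 0, ∀ h, 0 ≤ h → h ≤ h₀ → ∀ l : ℕ, l * h ≤ 1 - T →
      ‖∫ p, u (noisyState α β (1 - l * h) p) ∂(P₀.prod (stdGaussian (Euc N))) -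
        ∫ z, u (algState α β P₀ h l z) ∂(stdGaussian (Euc N))‖ < e := by
  obtain ⟨C, hC0, hC⟩ := exists_velocityJac_bound hI hP hT
  obtain ⟨C₁, hC₁⟩ := exists_interpolant_bound hI
  have hD := hu.nonneg
  have hW := weakWeight_nonneg N ρ C C₁
  set A := weakWeight N ρ C C₁ * (D * Real.exp (3 * C + C ^ 2)) with hA
  have hA0 : 0 ≤ A := by positivity
  set κ := min 1 (e / (3 * (A + 1))) with hκ
  have hκ0 : 0 < κ := lt_min one_pos (by positivity)
  obtain ⟨a, ha0, ha⟩ := exists_uniform_taylor hI.contDiff_alpha hκ0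
  obtain ⟨b, hb0, hb⟩ := exists_uniform_taylor hI.contDiff_beta hκ0
  refine ⟨min κ (min a b), lt_min hκ0 (lt_min ha0 hb0), fun h h0 hh l hl => ?_⟩
  have hhκ : h ≤ κ := hh.trans (min_le_left _ _)
  have hha : h ≤ a := hh.trans ((min_le_right _ _).trans (min_le_left _ _))
  have hhb : h ≤ b := hh.trans ((min_le_right _ _).trans (min_le_right _ _))
  have hlh1 : l * h ≤ 1 := by linarith
  refine (norm_weakError_le hI hP hT h0 (hhκ.trans (min_le_left _ _)) hκ0.le (min_le_left _ _)
    (fun t ht s hs hst => ha t ht s hs (hst.trans hha))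
    (fun t ht s hs hst => hb t ht s hs (hst.trans hhb))
    (fun t ht => hC₁ t ⟨hT.le.trans ht.1, ht.2⟩) hC0 hC l hl hu).trans_lt ?_
  have hexp := one_add_mul_pow_le_exp h0 (by positivity : 0 ≤ 3 * C + C ^ 2) hlh1
  calc l * h * (κ + h) * weakWeight N ρ C C₁ * (D * (1 + h * (3 * C + C ^ 2)) ^ l)
      ≤ 1 * (κ + κ) * weakWeight N ρ C C₁ * (D * Real.exp (3 * C + C ^ 2)) := by gcongr
    _ = 2 * κ * A := by rw [hA]; ring
    _ ≤ 2 * (e / (3 * (A + 1))) * A := by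
        have := min_le_right 1 (e / (3 * (A + 1)))
        gcongr
    _ < e := by
        rw [mul_div_assoc', div_mul_eq_mul_div, div_lt_iff₀ (by positivity)]
        nlinarith [mul_nonneg he.le hA0]

end WeakError

/-! ### Euler schemes under step halving -/

section EulerScheme

variable {E : Type*} [NormedAddCommGroup E] [NormedSpace ℝ E]

/-- `s` is the explicit Euler scheme with step `h` for `dY/dt = b t Y`, run backwards from time
`1`. -/
def IsEulerScheme (b : ℝ → E → E) (h : ℝ) (s : ℕ → E) : Prop :=
  ∀ l : ℕ, s (l + 1) = s l - h • b (1 - l * h) (s l)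

variable {b : ℝ → E → E} {T L B h : ℝ} {s : ℕ → E}

/-- Discrete Grönwall bound. -/
lemma IsEulerScheme.norm_le (hs : IsEulerScheme b h s) (hT : 0 ≤ T) (h0 : 0 ≤ h) (hL : 0 ≤ L)
    (hB : 0 ≤ B) (hb : ∀ t ∈ Icc T 1, ∀ y, ‖b t y‖ ≤ B + L * ‖y‖) (l : ℕ) (hl : l * h ≤ 1 - T) :
    ‖s l‖ ≤ Real.exp L * (‖s 0‖ + B) := by
  have key : ∀ l : ℕ, l * h ≤ 1 - T → ‖s l‖ ≤ (1 + h * L) ^ l * (‖s 0‖ + l * h * B) := by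
    intro l
    induction l with
    | zero => intro _; simp
    | succ l ih =>
      intro hl
      push_cast at hl
      have hlh : 0 ≤ l * h := by positivity
      have ih' := ih (by linarith)
      have hbl := hb (1 - l * h) ⟨by linarith, by linarith⟩ (s l)
      rw [hs l]
      refine (norm_sub_le _ _).trans ?_
      rw [norm_smul, Real.norm_eq_abs, abs_of_nonneg h0]
      have h1 : ‖s l‖ + h * ‖b (1 - l * h) (s l)‖ ≤ (1 + h * L) * ‖s l‖ + h * B * 1 := by
        have := mul_le_mul_of_nonneg_left hbl h0
        linarith
      have h2 : (1 + h * L) * ‖s l‖ ≤ (1 + h * L) * ((1 + h * L) ^ l * (‖s 0‖ + l * h * B)) := by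
        gcongr
      have h3 : h * B * 1 ≤ h * B * (1 + h * L) ^ (l + 1) :=
        mul_le_mul_of_nonneg_left (one_le_pow₀ (le_add_of_nonneg_right (by positivity)))
          (by positivity)
      push_cast
      calc _ ≤ (1 + h * L) * ((1 + h * L) ^ l * (‖s 0‖ + l * h * B)) +
            h * B * (1 + h * L) ^ (l + 1) := by linarith
        _ = _ := by ring
  have hl1 : l * h ≤ 1 := by linarith
  refine (key l hl).trans ?_
  have h1 := one_add_mul_pow_le_exp h0 hL hl1
  have h2 : l * h * B ≤ B := mul_le_of_le_one_left hB hl1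
  gcongr

/-- Halving the step of an Euler scheme moves it by at most a multiple of the step: two half steps
differ from a full step by `O(h²)`, and there are at most `1 / h` steps. The time regularity of the
field is only used on the ball that contains the finer scheme. -/
lemma IsEulerScheme.norm_sub_half_le {K M : ℝ} {r : ℕ → E} (hs : IsEulerScheme b h s)
    (hr : IsEulerScheme b (h / 2) r) (h00 : r 0 = s 0) (hT : 0 ≤ T) (h0 : 0 ≤ h) (hL : 0 ≤ L)
    (hB : 0 ≤ B) (hM : 0 ≤ M) (hb : ∀ t ∈ Icc T 1, ∀ y, ‖b t y‖ ≤ B + L * ‖y‖)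
    (hLip : ∀ t ∈ Icc T 1, ∀ y y', ‖b t y' - b t y‖ ≤ L * ‖y' - y‖)
    (hK : Real.exp L * (‖s 0‖ + B) ≤ K)
    (htime : ∀ t ∈ Icc T 1, ∀ t' ∈ Icc T 1, ∀ y, ‖y‖ ≤ K → ‖b t' y - b t y‖ ≤ M * |t' - t|)
    (l : ℕ) (hl : l * h ≤ 1 - T) :
    ‖s l - r (2 * l)‖ ≤ Real.exp L * (l * h ^ 2 * (L * (B + L * K) + M)) := by
  have hK0 : 0 ≤ K := le_trans (by positivity) hK
  have key : ∀ l : ℕ, l * h ≤ 1 - T →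
      ‖s l - r (2 * l)‖ ≤ (1 + h * L) ^ l * (l * h ^ 2 * (L * (B + L * K) + M)) := by
    intro l
    induction l with
    | zero => intro _; simp [h00]
    | succ l ih =>
      intro hl
      push_cast at hl
      have hlh : 0 ≤ l * h := by positivity
      have ih' := ih (by linarith)
      set t := 1 - l * h with ht
      have htT : t ∈ Icc T 1 := ⟨by linarith, by linarith⟩
      have htT' : t - h / 2 ∈ Icc T 1 := ⟨by linarith, by linarith⟩
      set y := r (2 * l) with hy
      have hyK : ‖y‖ ≤ K := by
        refine (hr.norm_le hT (by positivity) hL hB hb (2 * l) ?_).trans (by rwa [h00])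
        push_cast
        linarith
      have e1 : r (2 * l + 1) = y - (h / 2) • b t y := by
        have ht1 : 1 - ((2 * l : ℕ) : ℝ) * (h / 2) = t := by
          rw [ht]; push_cast; ring
        rw [hr (2 * l), ht1]
      set y₁ := y - (h / 2) • b t y with hy₁
      have e2 : r (2 * (l + 1)) = y₁ - (h / 2) • b (t - h / 2) y₁ := by
        have : 2 * (l + 1) = 2 * l + 1 + 1 := by ring
        have ht2 : 1 - ((2 * l + 1 : ℕ) : ℝ) * (h / 2) = t - h / 2 := by
          rw [ht]; push_cast; ring
        rw [this, hr (2 * l + 1), e1, ht2]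
      have e3 : s (l + 1) - r (2 * (l + 1)) = (s l - y) - h • (b t (s l) - b t y) +
          (h / 2) • ((b (t - h / 2) y - b t y) + (b (t - h / 2) y₁ - b (t - h / 2) y)) := by
        rw [e2, hs l, hy₁]
        module
      have n1 : ‖y₁ - y‖ ≤ h * (B + L * K) := by
        rw [hy₁, sub_sub_cancel_left, norm_neg, norm_smul, Real.norm_eq_abs,
          abs_of_nonneg (by positivity)]
        have := hb t htT y
        have h2 : h / 2 ≤ h := by linarith
        have h3 : L * ‖y‖ ≤ L * K := by gcongr
        exact mul_le_mul h2 (by linarith) (norm_nonneg _) h0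
      have n2 : ‖b (t - h / 2) y - b t y‖ ≤ M * h := by
        refine (htime t htT _ htT' y hyK).trans ?_
        rw [sub_sub_cancel_left, abs_neg, abs_of_nonneg (by positivity)]
        gcongr
        linarith
      have n3 : ‖b (t - h / 2) y₁ - b (t - h / 2) y‖ ≤ L * (h * (B + L * K)) :=
        (hLip _ htT' y y₁).trans (by gcongr)
      have n4 : ‖(h / 2) • ((b (t - h / 2) y - b t y) + (b (t - h / 2) y₁ - b (t - h / 2) y))‖ ≤
          h ^ 2 * (L * (B + L * K) + M) * 1 := by
        rw [norm_smul, Real.norm_eq_abs, abs_of_nonneg (by positivity)]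
        calc _ ≤ h * (M * h + L * (h * (B + L * K))) := by
              refine mul_le_mul (by linarith) ((norm_add_le _ _).trans (add_le_add n2 n3))
                (norm_nonneg _) h0
          _ = _ := by ring
      have n5 : ‖(s l - y) - h • (b t (s l) - b t y)‖ ≤ (1 + h * L) * ‖s l - y‖ := by
        refine (norm_sub_le _ _).trans ?_
        rw [norm_smul, Real.norm_eq_abs, abs_of_nonneg h0]
        have := mul_le_mul_of_nonneg_left (hLip t htT y (s l)) h0
        linarith
      have n6 : (1 + h * L) * ‖s l - y‖ ≤
          (1 + h * L) * ((1 + h * L) ^ l * (l * h ^ 2 * (L * (B + L * K) + M))) := by gcongr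
      have n7 : h ^ 2 * (L * (B + L * K) + M) * 1 ≤
          h ^ 2 * (L * (B + L * K) + M) * (1 + h * L) ^ (l + 1) :=
        mul_le_mul_of_nonneg_left (one_le_pow₀ (le_add_of_nonneg_right (by positivity)))
          (by positivity)
      rw [e3]
      refine (norm_add_le _ _).trans ?_
      push_cast
      calc _ ≤ (1 + h * L) * ((1 + h * L) ^ l * (l * h ^ 2 * (L * (B + L * K) + M))) +
            h ^ 2 * (L * (B + L * K) + M) * (1 + h * L) ^ (l + 1) := by linarith
        _ = _ := by ring
  refine (key l hl).trans ?_
  have h1 := one_add_mul_pow_le_exp h0 hL (by linarith : l * h ≤ 1)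
  gcongr

/-- Euler schemes with steps `h, h/2, h/4, …` converge, and the limit is within `O(h)` of the
first one. -/
lemma exists_tendsto_eulerScheme [CompleteSpace E] {K M : ℝ} {S : ℕ → ℕ → E} {z : E}
    (hS : ∀ k, IsEulerScheme b (h / 2 ^ k) (S k)) (hz : ∀ k, S k 0 = z) (hT : 0 ≤ T) (h0 : 0 ≤ h)
    (hL : 0 ≤ L) (hB : 0 ≤ B) (hM : 0 ≤ M) (hb : ∀ t ∈ Icc T 1, ∀ y, ‖b t y‖ ≤ B + L * ‖y‖)
    (hLip : ∀ t ∈ Icc T 1, ∀ y y', ‖b t y' - b t y‖ ≤ L * ‖y' - y‖)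
    (hK : Real.exp L * (‖z‖ + B) ≤ K)
    (htime : ∀ t ∈ Icc T 1, ∀ t' ∈ Icc T 1, ∀ y, ‖y‖ ≤ K → ‖b t' y - b t y‖ ≤ M * |t' - t|)
    (m : ℕ) (hm : m * h ≤ 1 - T) :
    ∃ x, Filter.Tendsto (fun k => S k (2 ^ k * m)) Filter.atTop (nhds x) ∧
      ‖S 0 m - x‖ ≤ 2 * Real.exp L * (L * (B + L * K) + M) * h := by
  have hK0 : 0 ≤ K := le_trans (by positivity) hK
  have hd : ∀ k, dist (S k (2 ^ k * m)) (S (k + 1) (2 ^ (k + 1) * m)) ≤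
      2 * Real.exp L * (L * (B + L * K) + M) * h / 2 / 2 ^ k := by
    intro k
    have hstep : h / 2 ^ k / 2 = h / 2 ^ (k + 1) := by rw [div_div, pow_succ]
    have htot : ((2 ^ k * m : ℕ) : ℝ) * (h / 2 ^ k) = m * h := by
      push_cast
      field_simp
    have hhalf := (hS k).norm_sub_half_le (r := S (k + 1)) (by rw [hstep]; exact hS (k + 1))
      (by rw [hz, hz]) hT (by positivity) hL hB hM hb hLip (by rw [hz]; exact hK) htime (2 ^ k * m)
      (by rw [htot]; exact hm)
    have hidx : 2 * (2 ^ k * m) = 2 ^ (k + 1) * m := by ring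
    rw [hidx] at hhalf
    rw [dist_eq_norm]
    refine hhalf.trans ?_
    have e : ((2 ^ k * m : ℕ) : ℝ) * (h / 2 ^ k) ^ 2 = (m * h) * (h / 2 ^ k) := by
      rw [pow_two, ← mul_assoc, htot]
    rw [e]
    have hmh : m * h ≤ 1 := by linarith
    calc Real.exp L * (m * h * (h / 2 ^ k) * (L * (B + L * K) + M)) ≤
        Real.exp L * (1 * (h / 2 ^ k) * (L * (B + L * K) + M)) := by gcongr
      _ = _ := by ring
  obtain ⟨x, hx⟩ := cauchySeq_tendsto_of_complete (cauchySeq_of_le_geometric_two hd)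
  refine ⟨x, hx, ?_⟩
  have := dist_le_of_le_geometric_two_of_tendsto₀ hd hx
  simpa [dist_eq_norm] using this

end EulerScheme

/-! ### Limits of Euler schemes -/

section CharacterTest

variable {E : Type*} [NormedAddCommGroup E] [InnerProductSpace ℝ E]

/-- The characters `y ↦ exp (i ⟪y, ξ⟫)` are test functions. -/
lemma exists_hasC11Bound_cexp_inner (ξ : E) :
    ∃ D u', HasC11Bound D (fun y : E => Complex.exp ((inner ℝ y ξ : ℝ) * Complex.I)) u' := by
  set ℓ : E →L[ℝ] ℂ := (Complex.ofRealCLM.comp (innerSL ℝ ξ)).smulRight Complex.I with hℓ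
  have hℓy : ∀ y, ((inner ℝ y ξ : ℝ) * Complex.I : ℂ) = ℓ y := by
    intro y
    simp [hℓ, innerSL_apply_apply ℝ, real_inner_comm]
  have hnorm : ∀ y, ‖Complex.exp (ℓ y)‖ = 1 := fun y => by
    rw [← hℓy, Complex.norm_exp_ofReal_mul_I]
  have hd : ∀ y, HasFDerivAt (fun y => Complex.exp (ℓ y)) (Complex.exp (ℓ y) • ℓ) y :=
    fun y => ℓ.hasFDerivAt.cexp
  have hd' : ∀ y, ‖Complex.exp (ℓ y) • ℓ‖ ≤ ‖ℓ‖ := fun y => by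
    rw [norm_smul, hnorm, one_mul]
  simp_rw [hℓy]
  refine ⟨1 + ‖ℓ‖ + ‖ℓ‖ ^ 2, fun y => Complex.exp (ℓ y) • ℓ, hd, fun y => ?_, fun y => ?_,
    fun y y' => ?_⟩
  · rw [hnorm]
    nlinarith [norm_nonneg ℓ, sq_nonneg ‖ℓ‖]
  · refine (hd' y).trans ?_
    nlinarith [norm_nonneg ℓ, sq_nonneg ‖ℓ‖]
  · have h1 : ‖Complex.exp (ℓ y') - Complex.exp (ℓ y)‖ ≤ ‖ℓ‖ * ‖y' - y‖ :=
      convex_univ.norm_image_sub_le_of_norm_hasFDerivWithin_le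
        (fun z _ => (hd z).hasFDerivWithinAt) (fun z _ => hd' z) (mem_univ y) (mem_univ y')
    rw [← sub_smul, norm_smul]
    have h2 := mul_le_mul_of_nonneg_right h1 (norm_nonneg ℓ)
    have h3 : 0 ≤ (1 + ‖ℓ‖) * ‖y' - y‖ := by positivity
    calc _ ≤ ‖ℓ‖ * ‖y' - y‖ * ‖ℓ‖ := h2
      _ ≤ ‖ℓ‖ * ‖y' - y‖ * ‖ℓ‖ + (1 + ‖ℓ‖) * ‖y' - y‖ := le_add_of_nonneg_right h3
      _ = _ := by ring

end CharacterTest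

section FieldBounds

variable {E : Type*} [NormedAddCommGroup E] [NormedSpace ℝ E]

/-- Bounds on a time-dependent vector field over `[T, 1]` that are homogeneous in a length scale
`r` (the square root of the dimension): linear growth, a Lipschitz bound in space, and a Lipschitz
bound in time on balls. -/
structure FieldBounds (b : ℝ → E → E) (T A B r : ℝ) (M : ℝ → ℝ) : Prop where
  growth : ∀ t ∈ Icc T 1, ∀ y, ‖b t y‖ ≤ B * r + A * ‖y‖
  lip : ∀ t ∈ Icc T 1, ∀ y y', ‖b t y' - b t y‖ ≤ A * ‖y' - y‖
  time : ∀ K > 0, ∀ t ∈ Icc T 1, ∀ t' ∈ Icc T 1, ∀ y, ‖y‖ ≤ K * r →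
    ‖b t' y - b t y‖ ≤ M K * r * |t' - t|

/-- The error constant of the Euler scheme started in the ball of radius `K * r`; the scheme then
stays in the ball of radius `exp A * (K + B) * r`. -/
noncomputable def eulerConst (A B : ℝ) (M : ℝ → ℝ) (K : ℝ) : ℝ :=
  2 * Real.exp A * (A * (B + A * (Real.exp A * (K + B))) + M (Real.exp A * (K + B)))

variable {b : ℝ → E → E} {T A B r h : ℝ} {M : ℝ → ℝ}

lemma FieldBounds.exists_tendsto [CompleteSpace E] (hF : FieldBounds b T A B r M) (hT : 0 ≤ T)
    (hA : 0 ≤ A) (hB : 0 ≤ B) (hr : 0 < r) (hM : ∀ K, 0 ≤ M K) (h0 : 0 ≤ h) {m : ℕ}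
    (hm : m * h ≤ 1 - T) {S : ℕ → ℕ → E} (hS : ∀ k, IsEulerScheme b (h / 2 ^ k) (S k)) {z : E}
    (hz : ∀ k, S k 0 = z) {K : ℝ} (hK : 0 < K) (hzK : ‖z‖ ≤ K * r) :
    ∃ x, Filter.Tendsto (fun k => S k (2 ^ k * m)) Filter.atTop (nhds x) ∧
      ‖S 0 m - x‖ ≤ eulerConst A B M K * r * h := by
  set K' := Real.exp A * (K + B) with hK'
  have hK'0 : 0 < K' := by positivity
  obtain ⟨x, hx, hxm⟩ := exists_tendsto_eulerScheme (b := b) (K := K' * r) (M := M K' * r) hS hz hT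
    h0 hA (mul_nonneg hB hr.le) (mul_nonneg (hM _) hr.le) hF.growth hF.lip (by
      rw [hK', mul_assoc]
      gcongr
      linarith) (hF.time K' hK'0) m hm
  refine ⟨x, hx, hxm.trans (le_of_eq ?_)⟩
  rw [eulerConst]
  ring

/-- Error of the Euler scheme for every starting point: first order in the step inside the ball of
radius `K * r`, and controlled by a fourth moment outside of it. -/
lemma FieldBounds.exists_limit [CompleteSpace E] (hF : FieldBounds b T A B r M) (hT : 0 ≤ T)
    (hA : 0 ≤ A) (hB : 0 ≤ B) (hr : 0 < r) (hM : ∀ K, 0 ≤ M K) (h0 : 0 ≤ h) {m : ℕ}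
    (hm : m * h ≤ 1 - T) {S : ℕ → ℕ → E} (hS : ∀ k, IsEulerScheme b (h / 2 ^ k) (S k)) {z : E}
    (hz : ∀ k, S k 0 = z) :
    ∃ x, Filter.Tendsto (fun k => S k (2 ^ k * m)) Filter.atTop (nhds x) ∧
      ∀ K ≥ 1, ‖S 0 m - x‖ ^ 2 ≤ (eulerConst A B M K * r * h) ^ 2 +
        (2 * Real.exp A * (1 + B)) ^ 2 / (K ^ 2 * r ^ 2) * ‖z‖ ^ 4 := by
  -- the limit exists for every `z`; its error bound is useful only for a fixed radius `K`, and is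
  -- transferred by uniqueness of limits
  obtain ⟨x, hx, -⟩ := hF.exists_tendsto hT hA hB hr hM h0 hm hS hz (K := ‖z‖ / r + 1)
    (by positivity) (by rw [add_mul, div_mul_cancel₀ _ hr.ne']; linarith)
  refine ⟨x, hx, fun K hK => ?_⟩
  have hK0 : 0 < K := by linarith
  rcases le_or_gt ‖z‖ (K * r) with hzK | hzK
  · obtain ⟨x', hx', hxm⟩ := hF.exists_tendsto hT hA hB hr hM h0 hm hS hz hK0 hzK
    rw [← tendsto_nhds_unique hx hx'] at hxm
    have h1 : ‖S 0 m - x‖ ^ 2 ≤ (eulerConst A B M K * r * h) ^ 2 := by gcongr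
    have h2 : 0 ≤ (2 * Real.exp A * (1 + B)) ^ 2 / (K ^ 2 * r ^ 2) * ‖z‖ ^ 4 := by positivity
    linarith
  · have hg : ∀ k, ‖S k (2 ^ k * m)‖ ≤ Real.exp A * (‖z‖ + B * r) := by
      intro k
      have htot : ((2 ^ k * m : ℕ) : ℝ) * (h / 2 ^ k) = m * h := by
        push_cast
        field_simp
      have := (hS k).norm_le hT (by positivity) hA (mul_nonneg hB hr.le) hF.growth (2 ^ k * m)
        (by rw [htot]; exact hm)
      rwa [hz] at this
    have hgx : ‖x‖ ≤ Real.exp A * (‖z‖ + B * r) :=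
      le_of_tendsto hx.norm (Filter.Eventually.of_forall hg)
    have hg0 : ‖S 0 m‖ ≤ Real.exp A * (‖z‖ + B * r) := by simpa using hg 0
    have hrz : r ≤ ‖z‖ := by nlinarith
    have h1 : ‖S 0 m - x‖ ≤ 2 * Real.exp A * (1 + B) * ‖z‖ := by
      have h2 : Real.exp A * (‖z‖ + B * r) ≤ Real.exp A * (‖z‖ + B * ‖z‖) := by gcongr
      have := norm_sub_le (S 0 m) x
      linarith
    have h3 : ‖S 0 m - x‖ ^ 2 ≤ (2 * Real.exp A * (1 + B) * ‖z‖) ^ 2 := by gcongr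
    have h4 : (K * r) ^ 2 ≤ ‖z‖ ^ 2 := by gcongr
    have h5 : (2 * Real.exp A * (1 + B) * ‖z‖) ^ 2 ≤
        (2 * Real.exp A * (1 + B)) ^ 2 / (K ^ 2 * r ^ 2) * ‖z‖ ^ 4 := by
      rw [div_mul_eq_mul_div, le_div_iff₀ (by positivity), mul_pow, mul_assoc]
      refine mul_le_mul_of_nonneg_left ?_ (sq_nonneg _)
      calc ‖z‖ ^ 2 * (K ^ 2 * r ^ 2) = ‖z‖ ^ 2 * (K * r) ^ 2 := by ring
        _ ≤ ‖z‖ ^ 2 * ‖z‖ ^ 2 := by gcongr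
        _ = ‖z‖ ^ 4 := by ring
    have h6 := sq_nonneg (eulerConst A B M K * r * h)
    linarith

end FieldBounds

section LimitState

variable {N : ℕ} {α β : ℝ → ℝ} {P₀ : Measure (Euc N)} {ρ : ℝ}

lemma isEulerScheme_algState [IsProbabilityMeasure P₀] (hP : ∀ᵐ x ∂P₀, ‖x‖ ≤ ρ) (h : ℝ)
    (z : Euc N) : IsEulerScheme (velocity α β P₀) h fun l => algState α β P₀ h l z := fun l => by
  simp only [algState]
  exact algStep_eq hP h _ _

/-- A pointwise limit of ever finer Euler schemes transports the noise to the law of the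
interpolant. -/
lemma map_limitState_eq (hI : IsInterpolant α β) [IsProbabilityMeasure P₀]
    (hP : ∀ᵐ x ∂P₀, ‖x‖ ≤ ρ) {T : ℝ} (hT : 0 < T) {h : ℝ} (h0 : 0 ≤ h) {m : ℕ}
    (hm : m * h ≤ 1 - T) {X : Euc N → Euc N} (hX : Measurable X)
    (hlim : ∀ z, Filter.Tendsto (fun k : ℕ => algState α β P₀ (h / 2 ^ k) (2 ^ k * m) z)
      Filter.atTop (nhds (X z))) :
    (stdGaussian (Euc N)).map X =
      (P₀.prod (stdGaussian (Euc N))).map (noisyState α β (1 - m * h)) := by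
  have hy := continuous_noisyState (N := N) (α := α) (β := β) (1 - m * h)
  have i1 : IsProbabilityMeasure ((stdGaussian (Euc N)).map X) :=
    Measure.isProbabilityMeasure_map hX.aemeasurable
  have i2 : IsProbabilityMeasure
      ((P₀.prod (stdGaussian (Euc N))).map (noisyState α β (1 - m * h))) :=
    Measure.isProbabilityMeasure_map hy.measurable.aemeasurable
  refine Measure.ext_of_charFun ?_
  ext ξ
  obtain ⟨D, u', hu⟩ := exists_hasC11Bound_cexp_inner ξ
  set u : Euc N → ℂ := fun y => Complex.exp ((inner ℝ y ξ : ℝ) * Complex.I) with hudef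
  rw [charFun_apply, charFun_apply, integral_map hX.aemeasurable
    hu.continuous.aestronglyMeasurable, integral_map hy.measurable.aemeasurable
    hu.continuous.aestronglyMeasurable]
  have l1 : Filter.Tendsto
      (fun k : ℕ => ∫ z, u (algState α β P₀ (h / 2 ^ k) (2 ^ k * m) z) ∂(stdGaussian (Euc N)))
      Filter.atTop (nhds (∫ z, u (X z) ∂(stdGaussian (Euc N)))) := by
    refine tendsto_integral_of_dominated_convergence (fun _ => D)
      (fun k => (hu.continuous.comp (continuous_algState hP _ _)).aestronglyMeasurable)
      (integrable_const D) (fun k => Filter.Eventually.of_forall fun z => hu.norm_le _)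
      (Filter.Eventually.of_forall fun z => ?_)
    exact (hu.continuous.tendsto _).comp (hlim z)
  have l2 : Filter.Tendsto
      (fun k : ℕ => ∫ z, u (algState α β P₀ (h / 2 ^ k) (2 ^ k * m) z) ∂(stdGaussian (Euc N)))
      Filter.atTop (nhds (∫ p, u (noisyState α β (1 - m * h) p)
        ∂(P₀.prod (stdGaussian (Euc N))))) := by
    refine Metric.tendsto_atTop'.2 fun e he => ?_
    obtain ⟨h₀, hh₀, H⟩ := exists_weakError_lt hI hP hT hu he
    have hsmall : ∀ᶠ k : ℕ in Filter.atTop, h / 2 ^ k ≤ h₀ := by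
      have : Filter.Tendsto (fun k : ℕ => h / 2 ^ k) Filter.atTop (nhds 0) := by
        have := (tendsto_pow_atTop_nhds_zero_of_lt_one (r := (1 / 2 : ℝ)) (by norm_num)
          (by norm_num)).const_mul h
        simpa [div_eq_mul_inv] using this
      exact this.eventually (Iic_mem_nhds hh₀)
    obtain ⟨k₀, hk₀⟩ := Filter.eventually_atTop.1 hsmall
    refine ⟨k₀, fun k hk => ?_⟩
    have htot : ((2 ^ k * m : ℕ) : ℝ) * (h / 2 ^ k) = m * h := by
      push_cast
      field_simp
    have := H (h / 2 ^ k) (by positivity) (hk₀ k hk.le) (2 ^ k * m) (by rw [htot]; exact hm)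
    rw [htot] at this
    rwa [dist_comm, dist_eq_norm]
  exact tendsto_nhds_unique l1 l2

end LimitState

/-! ### Dimension-free mean-square error -/

section StrongError

variable {N : ℕ} {α β : ℝ → ℝ} {P₀ : Measure (Euc N)} {ρ : ℝ}

lemma ae_norm_le_of_support_subset (h : P₀.support ⊆ Metric.closedBall 0 ρ) :
    ∀ᵐ x ∂P₀, ‖x‖ ≤ ρ := by
  filter_upwards [P₀.support_mem_ae] with x hx
  simpa using h hx

/-- The Jacobian bound on `(ε / 2, 1)` gives a Lipschitz bound on `[ε, 1]`; the endpoint `t = 1` is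
reached by continuity in time. -/
lemma norm_velocity_sub_le_of_fderiv (hI : IsInterpolant α β) [IsProbabilityMeasure P₀]
    (hP : ∀ᵐ x ∂P₀, ‖x‖ ≤ ρ) {ε Λ : ℝ} (hε : ε ∈ Ioo (0 : ℝ) 1)
    (hL : ∀ t ∈ Ioo (ε / 2) 1, ∀ y : Euc N,
      ‖fderiv ℝ (fun y' => velocity α β P₀ t y') y‖ ≤ Λ) :
    ∀ t ∈ Icc ε 1, ∀ y y' : Euc N,
      ‖velocity α β P₀ t y' - velocity α β P₀ t y‖ ≤ Λ * ‖y' - y‖ := by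
  have hlt : ∀ t ∈ Ico ε 1, ∀ y y' : Euc N,
      ‖velocity α β P₀ t y' - velocity α β P₀ t y‖ ≤ Λ * ‖y' - y‖ := by
    intro t ht y y'
    exact convex_univ.norm_image_sub_le_of_norm_fderiv_le (𝕜 := ℝ)
      (fun z _ => (hasFDerivAt_velocity hP t z).differentiableAt)
      (fun z _ => hL t ⟨by linarith [ht.1, hε.1], ht.2⟩ z) (mem_univ y) (mem_univ y')
  intro t ht y y'
  rcases ht.2.lt_or_eq with h1 | rfl
  · exact hlt t ⟨ht.1, h1⟩ y y'
  · have hsub : Ico ε 1 ⊆ Ioc (0 : ℝ) 1 := fun s hs => ⟨hε.1.trans_le hs.1, hs.2.le⟩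
    have hmem : (1 : ℝ) ∈ closure (Ico ε 1) := by
      rw [closure_Ico hε.2.ne]
      exact right_mem_Icc.2 hε.2.le
    have hc : ∀ y, ContinuousWithinAt (fun t => velocity α β P₀ t y) (Ico ε 1) 1 := fun y =>
      (continuousOn_velocity_time hI hP y 1 (right_mem_Ioc.2 one_pos)).mono hsub
    exact ContinuousWithinAt.closure_le hmem ((hc y').sub (hc y)).norm continuousWithinAt_const
      fun s hs => hlt s hs y y'

/-- The bound on the time derivative over `(ε / 2, 1)` gives a Lipschitz bound on `[ε, 1]`, with the
endpoint `t = 1` reached by continuity. -/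
lemma norm_velocity_time_sub_le (hI : IsInterpolant α β) [IsProbabilityMeasure P₀]
    (hP : ∀ᵐ x ∂P₀, ‖x‖ ≤ ρ) {ε Λ : ℝ} (hε : ε ∈ Ioo (0 : ℝ) 1) {y : Euc N}
    (hM : ∀ t ∈ Ioo (ε / 2) 1, DifferentiableAt ℝ (fun s => velocity α β P₀ s y) t ∧
      ‖deriv (fun s => velocity α β P₀ s y) t‖ ≤ Λ) :
    ∀ t ∈ Icc ε 1, ∀ t' ∈ Icc ε 1,
      ‖velocity α β P₀ t' y - velocity α β P₀ t y‖ ≤ Λ * |t' - t| := by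
  have key : ∀ t ∈ Icc ε 1, ∀ t' ∈ Icc ε 1, t ≤ t' →
      ‖velocity α β P₀ t' y - velocity α β P₀ t y‖ ≤ Λ * (t' - t) := by
    intro t ht t' ht' hle
    have hmem : ∀ s ∈ Ico t t', s ∈ Ioo (ε / 2) 1 := fun s hs =>
      ⟨by linarith [ht.1, hs.1, hε.1], hs.2.trans_le ht'.2⟩
    refine norm_image_sub_le_of_norm_deriv_right_le_segment
      (f := fun s => velocity α β P₀ s y) (f' := deriv fun s => velocity α β P₀ s y)
      ((continuousOn_velocity_time hI hP y).mono fun s hs => ?_)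
      (fun s hs => (hM s (hmem s hs)).1.hasDerivAt.hasDerivWithinAt)
      (fun s hs => (hM s (hmem s hs)).2) t' (right_mem_Icc.2 hle)
    exact ⟨hε.1.trans_le (ht.1.trans hs.1), hs.2.trans ht'.2⟩
  intro t ht t' ht'
  rcases le_total t t' with hle | hle
  · rw [abs_of_nonneg (by linarith)]
    exact key t ht t' ht' hle
  · rw [norm_sub_rev, abs_sub_comm, abs_of_nonneg (by linarith)]
    exact key t' ht' t ht hle

/-- The Euler scheme is close in mean square to an exact sample of the interpolant, at a rate that
depends neither on the dimension nor on the target law. -/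
lemma exists_limitState (hI : IsInterpolant α β) (R : ℝ) (L : ℝ → ℝ) (M : ℝ → ℝ → ℝ) {ε : ℝ}
    (hε : ε ∈ Ioo (0 : ℝ) 1) {θ : ℝ} (hθ : 0 < θ) :
    ∃ δ₀ > 0, ∀ (N : ℕ), 0 < N → ∀ (P₀ : Measure (Euc N)), IsProbabilityMeasure P₀ →
      (∀ᵐ x ∂P₀, ‖x‖ ≤ R * √N) →
      (∀ t ∈ Ioo (ε / 2) 1, ∀ y : Euc N,
        ‖fderiv ℝ (fun y' => velocity α β P₀ t y') y‖ ≤ L (ε / 2)) →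
      (∀ K > 0, ∀ t ∈ Ioo (ε / 2) 1, ∀ y : Euc N, ‖y‖ ≤ K * √N →
        DifferentiableAt ℝ (fun s => velocity α β P₀ s y) t ∧
          ‖deriv (fun s => velocity α β P₀ s y) t‖ ≤ M (ε / 2) K * √N) →
      ∀ δ, 0 ≤ δ → δ ≤ δ₀ → ∀ m : ℕ, m * δ ≤ 1 - ε →
        ∃ X : Euc N → Euc N, Measurable X ∧
          (stdGaussian (Euc N)).map X =
            (P₀.prod (stdGaussian (Euc N))).map (noisyState α β (1 - m * δ)) ∧
          ∫⁻ z, ENNReal.ofReal (‖algState α β P₀ δ m z - X z‖ ^ 2) ∂(stdGaussian (Euc N)) ≤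
            ENNReal.ofReal (N * θ) := by
  obtain ⟨C, hC0, hC⟩ := exists_coeff_bound hI hε.1
  set A := C + |L (ε / 2)| with hA
  set B := C * |R| with hB
  set M' : ℝ → ℝ := fun K => |M (ε / 2) K| with hM'
  have hA0 : 0 ≤ A := by positivity
  have hB0 : 0 ≤ B := by positivity
  have hM'0 : ∀ K, 0 ≤ M' K := fun K => abs_nonneg _
  set V := ∫ x, x ^ 4 ∂(gaussianReal 0 1) with hV
  have hV0 : 0 ≤ V := integral_nonneg fun x => by positivity
  set Q := (2 * Real.exp A * (1 + B)) ^ 2 with hQ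
  have hQ0 : 0 ≤ Q := sq_nonneg _
  -- the truncation radius is chosen so that the fourth-moment term is at most `θ / 2`
  set K := 1 + 2 * Q * V / θ with hK
  have hK1 : 1 ≤ K := by
    have : 0 ≤ 2 * Q * V / θ := by positivity
    linarith
  set c := eulerConst A B M' K with hc
  have hKθ : Q * V / K ^ 2 ≤ θ / 2 := by
    rw [div_le_iff₀ (by positivity)]
    have h1 : 2 * Q * V = (K - 1) * θ := by
      rw [hK]; field_simp; ring
    have h2 : K ≤ K ^ 2 := by nlinarith
    nlinarith
  refine ⟨min 1 (θ / (2 * (c ^ 2 + 1))), lt_min one_pos (by positivity), ?_⟩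
  intro N hN P₀ hprob hP hL hM δ hδ0 hδ m hm
  have hNr : (0 : ℝ) < N := by exact_mod_cast hN
  set r := √(N : ℝ) with hr
  have hr0 : 0 < r := Real.sqrt_pos.2 hNr
  have hr2 : r ^ 2 = N := Real.sq_sqrt hNr.le
  have hF : FieldBounds (velocity α β P₀) ε A B r M' := by
    refine ⟨fun t ht y => ?_, fun t ht y y' => ?_, fun K hK t ht t' ht' y hy => ?_⟩
    · obtain ⟨h₁, h₂, -⟩ := hC t ht
      refine (norm_velocity_le hP h₁ h₂ y).trans ?_
      have e1 : C * (R * r) ≤ C * (|R| * r) := by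
        gcongr
        exact le_abs_self R
      have e2 : 0 ≤ |L (ε / 2)| * ‖y‖ := by positivity
      rw [hA, hB]
      linarith
    · refine (norm_velocity_sub_le_of_fderiv hI hP hε hL t ht y y').trans ?_
      refine mul_le_mul_of_nonneg_right ?_ (norm_nonneg _)
      rw [hA]
      linarith [le_abs_self (L (ε / 2))]
    · refine (norm_velocity_time_sub_le hI hP hε (fun s hs => hM K hK s hs y hy) t ht t'
        ht').trans ?_
      refine mul_le_mul_of_nonneg_right (mul_le_mul_of_nonneg_right ?_ hr0.le) (abs_nonneg _)
      exact le_abs_self _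
  have hlim := fun z : Euc N => hF.exists_limit hε.1.le hA0 hB0 hr0 hM'0 hδ0 hm
    (S := fun k l => algState α β P₀ (δ / 2 ^ k) l z) (z := z)
    (fun k => isEulerScheme_algState hP _ z) (fun k => rfl)
  choose X hX hXm using hlim
  have hXmeas : Measurable X :=
    measurable_of_tendsto_metrizable
      (f := fun (k : ℕ) z => algState α β P₀ (δ / 2 ^ k) (2 ^ k * m) z)
      (fun k => (continuous_algState hP _ _).measurable) (tendsto_pi_nhds.2 hX)
  refine ⟨X, hXmeas, map_limitState_eq hI hP hε.1 hδ0 hm hXmeas hX, ?_⟩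
  have hpt : ∀ z, ‖algState α β P₀ δ m z - X z‖ ^ 2 ≤
      (c * r * δ) ^ 2 + Q / (K ^ 2 * r ^ 2) * ‖z‖ ^ 4 := by
    intro z
    simpa using hXm z K hK1
  have hint : Integrable (fun z : Euc N => (c * r * δ) ^ 2 + Q / (K ^ 2 * r ^ 2) * ‖z‖ ^ 4)
      (stdGaussian (Euc N)) :=
    (integrable_const _).add ((integrable_norm_pow_stdGaussian 4).const_mul _)
  refine (lintegral_mono fun z => ENNReal.ofReal_le_ofReal (hpt z)).trans ?_
  rw [← ofReal_integral_eq_lintegral_ofReal hint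
    (Filter.Eventually.of_forall fun z => by positivity)]
  refine ENNReal.ofReal_le_ofReal ?_
  rw [integral_add (integrable_const _) ((integrable_norm_pow_stdGaussian 4).const_mul _),
    integral_const_mul]
  have h4 := integral_norm_pow_four_stdGaussian_le (N := N)
  have e1 : (c * r * δ) ^ 2 ≤ N * (θ / 2) := by
    have hδ1 : δ ≤ 1 := hδ.trans (min_le_left _ _)
    have hδ2 : δ ≤ θ / (2 * (c ^ 2 + 1)) := hδ.trans (min_le_right _ _)
    rw [le_div_iff₀ (by positivity)] at hδ2
    have h5 : δ ^ 2 ≤ δ := by nlinarith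
    have h6 : c ^ 2 * δ ^ 2 ≤ θ / 2 := by nlinarith [mul_le_mul_of_nonneg_left h5 (sq_nonneg c)]
    calc (c * r * δ) ^ 2 = N * (c ^ 2 * δ ^ 2) := by rw [← hr2]; ring
      _ ≤ _ := by gcongr
  have e2 : Q / (K ^ 2 * r ^ 2) * ∫ z : Euc N, ‖z‖ ^ 4 ∂(stdGaussian (Euc N)) ≤ N * (θ / 2) := by
    calc _ ≤ Q / (K ^ 2 * r ^ 2) * (N ^ 2 * V) := by gcongr
      _ = N * (Q * V / K ^ 2) := by
        rw [hr2]; field_simp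
      _ ≤ _ := by gcongr
  simp only [integral_const, probReal_univ, one_smul]
  linarith

end StrongError

/-! ### Denoising error and gluing of couplings -/

section DenoisingError

variable {N : ℕ} {α β : ℝ → ℝ} {P₀ : Measure (Euc N)} {ρ : ℝ}

lemma norm_noisyState_sub_sq_le (t : ℝ) {p : Euc N × Euc N} (hp : ‖p.1‖ ≤ ρ) :
    ‖noisyState α β t p - p.1‖ ^ 2 ≤ 2 * (1 - α t) ^ 2 * ρ ^ 2 + 2 * β t ^ 2 * ‖p.2‖ ^ 2 := by
  have e : noisyState α β t p - p.1 = (α t - 1) • p.1 + β t • p.2 := by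
    rw [noisyState]; module
  have h1 : ‖noisyState α β t p - p.1‖ ≤ |1 - α t| * ρ + |β t| * ‖p.2‖ := by
    rw [e]
    refine (norm_add_le _ _).trans ?_
    rw [norm_smul, norm_smul, Real.norm_eq_abs, Real.norm_eq_abs, abs_sub_comm]
    gcongr
  calc _ ≤ (|1 - α t| * ρ + |β t| * ‖p.2‖) ^ 2 := by gcongr
    _ ≤ 2 * ((|1 - α t| * ρ) ^ 2 + (|β t| * ‖p.2‖) ^ 2) := add_sq_le
    _ = _ := by rw [mul_pow, mul_pow, sq_abs, sq_abs]; ring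

lemma integrable_norm_noisyState_sub_sq [IsProbabilityMeasure P₀] (hP : ∀ᵐ x ∂P₀, ‖x‖ ≤ ρ)
    (t : ℝ) : Integrable (fun p => ‖noisyState α β t p - p.1‖ ^ 2)
      (P₀.prod (stdGaussian (Euc N))) := by
  have h : Integrable (fun p : Euc N × Euc N =>
      2 * (1 - α t) ^ 2 * ρ ^ 2 + 2 * β t ^ 2 * ‖p.2‖ ^ 2) (P₀.prod (stdGaussian (Euc N))) :=
    (integrable_const _).add ((integrable_norm_snd_pow 2).const_mul _)
  refine h.mono'
    (((continuous_noisyState t).sub continuous_fst).norm.pow 2).aestronglyMeasurable ?_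
  filter_upwards [ae_fst_norm_le hP] with p hp
  rw [Real.norm_eq_abs, abs_of_nonneg (sq_nonneg _)]
  exact norm_noisyState_sub_sq_le t hp

lemma integral_norm_noisyState_sub_sq_le [IsProbabilityMeasure P₀] (hP : ∀ᵐ x ∂P₀, ‖x‖ ≤ ρ)
    (t : ℝ) : ∫ p, ‖noisyState α β t p - p.1‖ ^ 2 ∂(P₀.prod (stdGaussian (Euc N))) ≤
      2 * (1 - α t) ^ 2 * ρ ^ 2 + 2 * β t ^ 2 * N := by
  have h2 : Integrable (fun p : Euc N × Euc N => 2 * β t ^ 2 * ‖p.2‖ ^ 2)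
      (P₀.prod (stdGaussian (Euc N))) := (integrable_norm_snd_pow 2).const_mul _
  have h3 : ∫ p : Euc N × Euc N, ‖p.2‖ ^ 2 ∂(P₀.prod (stdGaussian (Euc N))) = N := by
    have := integral_fun_snd (μ := P₀) (ν := stdGaussian (Euc N)) (fun z : Euc N => ‖z‖ ^ 2)
    simpa [integral_norm_sq_stdGaussian] using this
  calc _ ≤ ∫ p : Euc N × Euc N, (2 * (1 - α t) ^ 2 * ρ ^ 2 + 2 * β t ^ 2 * ‖p.2‖ ^ 2)
        ∂(P₀.prod (stdGaussian (Euc N))) := by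
        refine integral_mono_ae (integrable_norm_noisyState_sub_sq hP t)
          ((integrable_const _).add h2) ?_
        filter_upwards [ae_fst_norm_le hP] with p hp using norm_noisyState_sub_sq_le t hp
    _ = _ := by
        have h4 : ∫ p : Euc N × Euc N, 2 * β t ^ 2 * ‖p.2‖ ^ 2 ∂(P₀.prod (stdGaussian (Euc N))) =
            2 * β t ^ 2 * N := by rw [integral_const_mul, h3]
        rw [integral_add (integrable_const _) h2, h4]
        simp

/-- The denoiser is at least as good an estimate of `x₀` as the noisy state itself, because
`x₀ - x̂₀` is orthogonal to `x̂₀ - y(t)`. -/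
lemma integral_norm_denoiser_sub_sq_le [IsProbabilityMeasure P₀] (hP : ∀ᵐ x ∂P₀, ‖x‖ ≤ ρ) {t : ℝ}
    (hb : 0 < β t) :
    Integrable (fun p => ‖denoiser α β P₀ t (noisyState α β t p) - p.1‖ ^ 2)
      (P₀.prod (stdGaussian (Euc N))) ∧
    ∫ p, ‖denoiser α β P₀ t (noisyState α β t p) - p.1‖ ^ 2 ∂(P₀.prod (stdGaussian (Euc N))) ≤
      ∫ p, ‖noisyState α β t p - p.1‖ ^ 2 ∂(P₀.prod (stdGaussian (Euc N))) := by
  have hρ := nonneg_of_ae_norm_le hP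
  have hy := continuous_noisyState (N := N) (α := α) (β := β) t
  have hd := continuous_denoiser (α := α) (β := β) hP t
  set μ := P₀.prod (stdGaussian (Euc N)) with hμ
  set G : Euc N → Euc N →L[ℝ] ℝ := fun y => (2 : ℝ) • innerSL ℝ (denoiser α β P₀ t y - y) with hG
  have hGc' : Continuous fun y => innerSL ℝ (denoiser α β P₀ t y - y) :=
    (innerSL ℝ).continuous.comp (hd.sub continuous_id)
  have hGc : Continuous G := hGc'.const_smul (2 : ℝ)
  have hGb : ∀ y, ‖G y‖ ≤ 2 * (ρ + ‖y‖) := by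
    intro y
    rw [hG, norm_smul, innerSL_apply_norm, Real.norm_eq_abs, abs_two]
    have h1 := norm_sub_le (denoiser α β P₀ t y) y
    have h2 := norm_denoiser_le (α := α) (β := β) hP t y
    linarith
  have h0 := integral_clm_apply_sub_denoiser (α := α) hP hb hGc (C := 2 * (ρ + 1)) fun y =>
    (hGb y).trans (by nlinarith [norm_nonneg y, mul_nonneg hρ (norm_nonneg y)])
  rw [← hμ] at h0
  have hres : ∀ᵐ p ∂μ, ‖p.1 - denoiser α β P₀ t (noisyState α β t p)‖ ≤ 2 * ρ := by
    filter_upwards [ae_fst_norm_le hP] with p hp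
    have h1 := norm_sub_le p.1 (denoiser α β P₀ t (noisyState α β t p))
    have h2 := norm_denoiser_le (α := α) (β := β) hP t (noisyState α β t p)
    linarith
  have i1 : Integrable (fun p => ‖denoiser α β P₀ t (noisyState α β t p) - p.1‖ ^ 2) μ := by
    refine (integrable_const ((2 * ρ) ^ 2)).mono'
      (((hd.comp hy).sub continuous_fst).norm.pow 2).aestronglyMeasurable ?_
    filter_upwards [hres] with p hp
    rw [Real.norm_eq_abs, abs_of_nonneg (sq_nonneg _), norm_sub_rev]
    gcongr
  have i2 := integrable_norm_noisyState_sub_sq (α := α) (β := β) hP t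
  have i3 : Integrable (fun p => G (noisyState α β t p)
      (p.1 - denoiser α β P₀ t (noisyState α β t p))) μ := by
    have hdom : Integrable (fun p : Euc N × Euc N =>
        2 * (ρ + (|α t| * ρ + |β t| * ‖p.2‖ ^ 1)) * (2 * ρ)) μ :=
      (((integrable_const _).add ((integrable_const _).add
        ((integrable_norm_snd_pow 1).const_mul _))).const_mul _).mul_const _
    refine hdom.mono' ((hGc.comp hy).clm_apply
      (continuous_fst.sub (hd.comp hy))).aestronglyMeasurable ?_
    filter_upwards [hres, ae_fst_norm_le hP] with p hp hp1
    refine (ContinuousLinearMap.le_opNorm _ _).trans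
      (mul_le_mul ((hGb _).trans ?_) hp (norm_nonneg _) (by positivity))
    have : ‖noisyState α β t p‖ ≤ |α t| * ρ + |β t| * ‖p.2‖ ^ 1 := by
      rw [noisyState]
      refine (norm_add_le _ _).trans ?_
      rw [norm_smul, norm_smul, Real.norm_eq_abs, Real.norm_eq_abs, pow_one]
      gcongr
    linarith
  refine ⟨i1, ?_⟩
  have hle : ∀ p, ‖denoiser α β P₀ t (noisyState α β t p) - p.1‖ ^ 2 ≤
      ‖noisyState α β t p - p.1‖ ^ 2 - G (noisyState α β t p)
      (p.1 - denoiser α β P₀ t (noisyState α β t p)) := by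
    intro p
    generalize hy' : noisyState α β t p = y
    generalize hm' : denoiser α β P₀ t y = m
    have e1 : G y (p.1 - m) = 2 * inner ℝ (m - y) (p.1 - m) := by
      rw [hG, ← hm']
      simp only [smul_apply, smul_eq_mul, innerSL_apply_apply ℝ]
    have e2 : y - p.1 = -((m - y) + (p.1 - m)) := by abel
    rw [e1, e2, norm_neg, norm_add_sq_real, norm_sub_rev m p.1]
    nlinarith [sq_nonneg ‖m - y‖]
  have hle2 := integral_mono i1 (i2.sub i3) hle
  have e : ∫ p, (‖noisyState α β t p - p.1‖ ^ 2 - G (noisyState α β t p)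
      (p.1 - denoiser α β P₀ t (noisyState α β t p))) ∂μ =
      ∫ p, ‖noisyState α β t p - p.1‖ ^ 2 ∂μ := by
    rw [integral_sub i2 i3]
    unfold noisyState
    rw [h0, sub_zero]
  exact hle2.trans (le_of_eq e)

end DenoisingError

section Gluing

variable {N : ℕ}

lemma ofReal_sq_le_of_le_add {a b c : ℝ} (hc : 0 ≤ c) (h : c ≤ a + b) : ENNReal.ofReal (c ^ 2) ≤
    2 * ENNReal.ofReal (a ^ 2) + 2 * ENNReal.ofReal (b ^ 2) := by
  have h2 : (2 : ENNReal) = ENNReal.ofReal 2 := by simp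
  rw [h2, ← ENNReal.ofReal_mul two_pos.le, ← ENNReal.ofReal_mul two_pos.le,
    ← ENNReal.ofReal_add (by positivity) (by positivity)]
  refine ENNReal.ofReal_le_ofReal ?_
  calc c ^ 2 ≤ (a + b) ^ 2 := by gcongr
    _ ≤ 2 * (a ^ 2 + b ^ 2) := add_sq_le
    _ = _ := by ring

/-- Gluing of couplings: if `X` and `Y` have the same law, a pair `(Y, W)` can be matched with a
pair `(X, ·)` by drawing the second entry from the conditional law of `W` given `Y = X`. -/
lemma exists_glued_measure {Ω₁ Ω₂ E E' : Type*} [MeasurableSpace Ω₁] [MeasurableSpace Ω₂]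
    [MeasurableSpace E] [MeasurableSpace E'] [StandardBorelSpace E'] [Nonempty E']
    (γ : Measure Ω₁) [IsProbabilityMeasure γ] (μ : Measure Ω₂) [IsProbabilityMeasure μ]
    {X : Ω₁ → E} {Y : Ω₂ → E} {W : Ω₂ → E'} (hX : Measurable X) (hY : Measurable Y)
    (hW : Measurable W) (hXY : γ.map X = μ.map Y) :
    ∃ ν : Measure (Ω₁ × E'), ν.map Prod.fst = γ ∧
      ν.map (fun q => (X q.1, q.2)) = μ.map (fun p => (Y p, W p)) := by
  have hYW : Measurable fun p => (Y p, W p) := hY.prodMk hW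
  set r := μ.map (fun p => (Y p, W p)) with hr
  have : IsProbabilityMeasure r := Measure.isProbabilityMeasure_map hYW.aemeasurable
  have hfst : r.fst = γ.map X := by
    rw [Measure.fst, hr, Measure.map_map measurable_fst hYW, hXY]
    rfl
  have hXid : Measurable fun q : Ω₁ × E' => (X q.1, q.2) :=
    (hX.comp measurable_fst).prodMk measurable_snd
  refine ⟨γ ⊗ₘ (r.condKernel.comap X hX), ?_, ?_⟩
  · exact Measure.fst_compProd γ (r.condKernel.comap X hX)
  · refine Measure.ext_of_lintegral _ fun f hf => ?_
    have e := r.disintegrate r.condKernel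
    have hfX : Measurable fun q : Ω₁ × E' => f (X q.1, q.2) := hf.comp hXid
    rw [lintegral_map hf hXid, Measure.lintegral_compProd hfX]
    conv_rhs => rw [← e]
    rw [Measure.lintegral_compProd hf, hfst, lintegral_map hf.lintegral_kernel_prod_right' hX]
    rfl

/-- If `X` under `γ` has the law of `Y`, the law of `A` is coupled with the law of `W` by gluing
along `X = Y`; the cost splits into the error of `A` against `Φ ∘ X` and the error of `Φ ∘ Y` as an
estimate of `W`. -/
lemma exists_coupling_cost_le {Ω E : Type*} [MeasurableSpace Ω] [NormedAddCommGroup E]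
    [MeasurableSpace E] [BorelSpace E] [SecondCountableTopology E] [StandardBorelSpace E]
    {γ P : Measure E} [IsProbabilityMeasure γ]
    {μ : Measure Ω} [IsProbabilityMeasure μ] {X A Φ : E → E} {Y W : Ω → E}
    (hX : Measurable X) (hA : Measurable A) (hΦ : Measurable Φ) (hY : Measurable Y)
    (hW : Measurable W) (hP : μ.map W = P) (hXY : γ.map X = μ.map Y) :
    ∃ π : Measure (E × E), (π.map Prod.fst = γ.map A ∧ π.map Prod.snd = P) ∧
      ∫⁻ p, ENNReal.ofReal (‖p.1 - p.2‖ ^ 2) ∂π ≤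
        2 * ∫⁻ z, ENNReal.ofReal (‖A z - Φ (X z)‖ ^ 2) ∂γ +
          2 * ∫⁻ p, ENNReal.ofReal (‖Φ (Y p) - W p‖ ^ 2) ∂μ := by
  obtain ⟨ν, hν1, hν2⟩ := exists_glued_measure γ μ hX hY hW hXY
  have hAid : Measurable fun q : E × E => (A q.1, q.2) :=
    (hA.comp measurable_fst).prodMk measurable_snd
  have hXid : Measurable fun q : E × E => (X q.1, q.2) :=
    (hX.comp measurable_fst).prodMk measurable_snd
  have hYW : Measurable fun p => (Y p, W p) := hY.prodMk hW
  have hsnd : ν.map Prod.snd = P := by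
    have h1 : (ν.map (fun q => (X q.1, q.2))).map Prod.snd = ν.map Prod.snd := by
      rw [Measure.map_map measurable_snd hXid]; rfl
    rw [← h1, hν2, Measure.map_map measurable_snd hYW, ← hP]
    rfl
  have hfst : (ν.map (fun q => (A q.1, q.2))).map Prod.fst = γ.map A := by
    rw [Measure.map_map measurable_fst hAid, ← hν1, Measure.map_map hA measurable_fst]
    rfl
  have hsnd' : (ν.map (fun q => (A q.1, q.2))).map Prod.snd = P := by
    rw [Measure.map_map measurable_snd hAid, ← hsnd]
    rfl
  refine ⟨ν.map (fun q => (A q.1, q.2)), ⟨hfst, hsnd'⟩, ?_⟩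
  have hcost : Measurable fun p : E × E => ENNReal.ofReal (‖p.1 - p.2‖ ^ 2) := by fun_prop
  have hAX : Measurable fun z => ENNReal.ofReal (‖A z - Φ (X z)‖ ^ 2) :=
    ((hA.sub (hΦ.comp hX)).norm.pow_const 2).ennreal_ofReal
  have hΦid : Measurable fun p : E × E => ENNReal.ofReal (‖Φ p.1 - p.2‖ ^ 2) :=
    (((hΦ.comp measurable_fst).sub measurable_snd).norm.pow_const 2).ennreal_ofReal
  rw [lintegral_map hcost hAid]
  calc ∫⁻ q, ENNReal.ofReal (‖A q.1 - q.2‖ ^ 2) ∂ν ≤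
      ∫⁻ q, (2 * ENNReal.ofReal (‖A q.1 - Φ (X q.1)‖ ^ 2) +
        2 * ENNReal.ofReal (‖Φ (X q.1) - q.2‖ ^ 2)) ∂ν :=
        lintegral_mono fun q => ofReal_sq_le_of_le_add (norm_nonneg _)
          (norm_sub_le_norm_sub_add_norm_sub _ _ _)
    _ = 2 * ∫⁻ q, ENNReal.ofReal (‖A q.1 - Φ (X q.1)‖ ^ 2) ∂ν +
        2 * ∫⁻ q, ENNReal.ofReal (‖Φ (X q.1) - q.2‖ ^ 2) ∂ν := by
        have m1 : Measurable fun q : E × E => ENNReal.ofReal (‖A q.1 - Φ (X q.1)‖ ^ 2) :=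
          hAX.comp measurable_fst
        have m2 : Measurable fun q : E × E => ENNReal.ofReal (‖Φ (X q.1) - q.2‖ ^ 2) :=
          hΦid.comp hXid
        rw [lintegral_add_left (m1.const_mul 2), lintegral_const_mul _ m1,
          lintegral_const_mul _ m2]
    _ = _ := by
        have e1 := lintegral_map (μ := ν) hAX measurable_fst
        have e2 := lintegral_map (μ := ν) hΦid hXid
        have e3 := lintegral_map (μ := μ) hΦid hYW
        rw [hν1] at e1
        rw [hν2, e3] at e2
        rw [e1, e2]

lemma wasserstein2_cost_le {Ω : Type*} [MeasurableSpace Ω] {γ P : Measure (Euc N)}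
    [IsProbabilityMeasure γ]
    {μ : Measure Ω} [IsProbabilityMeasure μ] {X A Φ : Euc N → Euc N} {Y W : Ω → Euc N}
    (hX : Measurable X) (hA : Measurable A) (hΦ : Measurable Φ) (hY : Measurable Y)
    (hW : Measurable W) (hP : μ.map W = P) (hXY : γ.map X = μ.map Y) :
    ⨅ π ∈ {π : Measure (Euc N × Euc N) | π.map Prod.fst = γ.map A ∧ π.map Prod.snd = P},
      ∫⁻ p, ENNReal.ofReal (‖p.1 - p.2‖ ^ 2) ∂π ≤
    2 * ∫⁻ z, ENNReal.ofReal (‖A z - Φ (X z)‖ ^ 2) ∂γ +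
      2 * ∫⁻ p, ENNReal.ofReal (‖Φ (Y p) - W p‖ ^ 2) ∂μ := by
  obtain ⟨π, hπ, hcost⟩ := exists_coupling_cost_le hX hA hΦ hY hW hP hXY
  exact (iInf₂_le π hπ).trans hcost

lemma wasserstein2_div_lt {μ ν : Measure (Euc N)} (hN : 0 < N) {s η : ℝ} (hs : 0 ≤ s)
    (hη : 0 < η) (hsη : s < η ^ 2)
    (h : ⨅ π ∈ {π : Measure (Euc N × Euc N) | π.map Prod.fst = μ ∧ π.map Prod.snd = ν},
      ∫⁻ p, ENNReal.ofReal (‖p.1 - p.2‖ ^ 2) ∂π ≤ ENNReal.ofReal (N * s)) :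
    wasserstein2 μ ν / ENNReal.ofReal √N < ENNReal.ofReal η := by
  have hr : 0 < √(N : ℝ) := Real.sqrt_pos.2 (by exact_mod_cast hN)
  rw [ENNReal.div_lt_iff (Or.inl (by simpa using hr)) (Or.inl ENNReal.ofReal_ne_top),
    ← ENNReal.ofReal_mul hη.le, wasserstein2]
  refine (ENNReal.rpow_le_rpow h (by norm_num)).trans_lt ?_
  rw [ENNReal.ofReal_rpow_of_nonneg (by positivity) (by norm_num), ← Real.sqrt_eq_rpow,
    Real.sqrt_mul (by positivity), mul_comm]
  refine (ENNReal.ofReal_lt_ofReal_iff (by positivity)).2 ?_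
  refine mul_lt_mul_of_pos_right ?_ hr
  exact (Real.sqrt_lt' hη).2 hsη

end Gluing

/-! ### Choice of the final time and conclusion -/

section Conclusion

variable {N : ℕ} {α β : ℝ → ℝ} {P₀ : Measure (Euc N)} {ρ : ℝ}

/-- The comparison of a function `A` of the initial noise with the target, through a variable `X`
with the law of the noisy observation `Y` and an estimator `Φ` applied to it. -/
lemma wasserstein2_div_lt_of_limitState (hN : 0 < N) [IsProbabilityMeasure P₀] {θ₁ θ₂ η : ℝ}
    (h₁ : 0 ≤ θ₁) (h₂ : 0 ≤ θ₂) (hη : 0 < η) (hθ : 2 * θ₁ + 2 * θ₂ < η ^ 2)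
    {A Φ X : Euc N → Euc N} {Y : Euc N × Euc N → Euc N} (hA : Measurable A) (hΦ : Measurable Φ)
    (hX : Measurable X) (hY : Measurable Y)
    (hXY : (stdGaussian (Euc N)).map X = (P₀.prod (stdGaussian (Euc N))).map Y)
    (hAX : ∫⁻ z, ENNReal.ofReal (‖A z - Φ (X z)‖ ^ 2) ∂(stdGaussian (Euc N)) ≤
      ENNReal.ofReal (N * θ₁))
    (hΦY : ∫⁻ p, ENNReal.ofReal (‖Φ (Y p) - p.1‖ ^ 2) ∂(P₀.prod (stdGaussian (Euc N))) ≤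
      ENNReal.ofReal (N * θ₂)) :
    wasserstein2 ((stdGaussian (Euc N)).map A) P₀ / ENNReal.ofReal √N < ENNReal.ofReal η := by
  have hfst : (P₀.prod (stdGaussian (Euc N))).map Prod.fst = P₀ := by
    rw [Measure.map_fst_prod, measure_univ, one_smul]
  refine wasserstein2_div_lt hN (s := 2 * θ₁ + 2 * θ₂) (by positivity) hη hθ ?_
  refine (wasserstein2_cost_le hX hA hΦ hY measurable_fst hfst hXY).trans
    ((add_le_add (mul_le_mul_right hAX 2) (mul_le_mul_right hΦY 2)).trans (le_of_eq ?_))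
  have h2 : (2 : ENNReal) = ENNReal.ofReal 2 := by simp
  rw [h2, ← ENNReal.ofReal_mul two_pos.le, ← ENNReal.ofReal_mul two_pos.le,
    ← ENNReal.ofReal_add (by positivity) (by positivity)]
  congr 1
  ring

/-- Where `denoiserCoeff` does not vanish, the denoiser inherits a Lipschitz bound from the
velocity field. -/
lemma norm_denoiser_sub_le [IsProbabilityMeasure P₀] (hP : ∀ᵐ x ∂P₀, ‖x‖ ≤ ρ) {t c₀ C Λ : ℝ}
    (hc₀ : 0 < c₀) (hc : c₀ ≤ |denoiserCoeff α β t|) (hC : |stateCoeff β t| ≤ C)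
    (hΛ : ∀ y y' : Euc N, ‖velocity α β P₀ t y' - velocity α β P₀ t y‖ ≤ Λ * ‖y' - y‖)
    (y y' : Euc N) :
    ‖denoiser α β P₀ t y' - denoiser α β P₀ t y‖ ≤ (Λ + C) / c₀ * ‖y' - y‖ := by
  have e : denoiserCoeff α β t • (denoiser α β P₀ t y' - denoiser α β P₀ t y) =
      (velocity α β P₀ t y' - velocity α β P₀ t y) - stateCoeff β t • (y' - y) := by
    rw [velocity_eq hP, velocity_eq hP]
    module
  have h1 : |denoiserCoeff α β t| * ‖denoiser α β P₀ t y' - denoiser α β P₀ t y‖ ≤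
      (Λ + C) * ‖y' - y‖ := by
    rw [← Real.norm_eq_abs, ← norm_smul, e]
    refine (norm_sub_le _ _).trans ?_
    rw [norm_smul, Real.norm_eq_abs, add_mul]
    exact add_le_add (hΛ y y') (mul_le_mul_of_nonneg_right hC (norm_nonneg _))
  rw [div_mul_eq_mul_div, le_div_iff₀ hc₀, mul_comm]
  exact (mul_le_mul_of_nonneg_right hc (norm_nonneg _)).trans h1

/-- Near time `0` the interpolant is close to the target, and `α` is positive. -/
lemma exists_time_interpolant_close (hI : IsInterpolant α β) (R : ℝ) {e : ℝ} (he : 0 < e) :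
    ∃ t₁ ∈ Ioo (0 : ℝ) 1, ∀ t ∈ Ioc 0 t₁,
      0 < α t ∧ 2 * (1 - α t) ^ 2 * R ^ 2 + 2 * β t ^ 2 < e := by
  have h0 : (0 : ℝ) ∈ Icc (0 : ℝ) 1 := left_mem_Icc.2 zero_le_one
  have hα := hI.contDiff_alpha.continuousOn
  have hβ := hI.contDiff_beta.continuousOn
  have hg : ContinuousOn (fun t => 2 * (1 - α t) ^ 2 * R ^ 2 + 2 * β t ^ 2) (Icc 0 1) :=
    ((continuousOn_const.mul ((continuousOn_const.sub hα).pow 2)).mul continuousOn_const).add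
      (continuousOn_const.mul (hβ.pow 2))
  have hα0 : 0 < α 0 := by rw [hI.alpha_zero]; exact one_pos
  have hg0 : 2 * (1 - α 0) ^ 2 * R ^ 2 + 2 * β 0 ^ 2 < e := by
    simpa [hI.alpha_zero, hI.beta_zero] using he
  have hev := ((hα 0 h0).eventually (lt_mem_nhds hα0)).and ((hg 0 h0).eventually (gt_mem_nhds hg0))
  obtain ⟨r, hr, H⟩ := Metric.mem_nhdsWithin_iff.1 hev
  have hm : 0 < min r 1 := lt_min hr one_pos
  have hm1 := min_le_left r 1
  have hm2 := min_le_right r 1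
  refine ⟨min r 1 / 2, ⟨by linarith, by linarith⟩, fun t ht => H ⟨?_, ht.1.le, by linarith [ht.2]⟩⟩
  rw [Metric.mem_ball, Real.dist_eq, sub_zero, abs_of_pos ht.1]
  linarith [ht.2]

/-- There are arbitrarily small times around which `denoiserCoeff` stays away from `0`, because
`β` has to increase on every interval `[0, t₁]`. -/
lemma exists_time_denoiserCoeff_ne_zero (hI : IsInterpolant α β) {t₁ : ℝ}
    (ht₁ : t₁ ∈ Ioo (0 : ℝ) 1) (hα : ∀ t ∈ Ioc 0 t₁, 0 < α t) :
    ∃ ε ∈ Ioo 0 t₁, ∃ c₀ > 0, ∃ r > 0, ∀ t ∈ Ioc (0 : ℝ) 1, |t - ε| < r →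
      c₀ ≤ |denoiserCoeff α β t| := by
  have hsub : Icc 0 t₁ ⊆ Icc (0 : ℝ) 1 := Icc_subset_Icc_right ht₁.2.le
  have hnhds : ∀ t ∈ Ioo 0 t₁, Icc (0 : ℝ) 1 ∈ nhds t := fun t ht =>
    Icc_mem_nhds ht.1 (ht.2.trans ht₁.2)
  obtain ⟨ε, hε, hslope⟩ := exists_deriv_eq_slope β ht₁.1 (hI.contDiff_beta.continuousOn.mono hsub)
    fun t ht => ((hI.contDiff_beta.differentiableOn (by norm_num) t
      (hsub (Ioo_subset_Icc_self ht))).differentiableAt (hnhds t ht)).differentiableWithinAt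
  have hβ' : 0 < timeDeriv β ε := by
    rw [timeDeriv, derivWithin_of_mem_nhds (hnhds ε hε), hslope, hI.beta_zero, sub_zero, sub_zero]
    exact div_pos (hI.beta_pos t₁ ⟨ht₁.1, ht₁.2.le⟩) ht₁.1
  have hε1 : ε ∈ Ioc (0 : ℝ) 1 := ⟨hε.1, (hε.2.trans ht₁.2).le⟩
  have hneg : denoiserCoeff α β ε < 0 := by
    have h1 := hI.deriv_alpha_nonpos ε (Ioc_subset_Icc_self hε1)
    have h2 : 0 < timeDeriv β ε * α ε / β ε :=
      div_pos (mul_pos hβ' (hα ε ⟨hε.1, hε.2.le⟩)) (hI.beta_pos ε hε1)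
    rw [denoiserCoeff]
    linarith
  have hlt : denoiserCoeff α β ε < denoiserCoeff α β ε / 2 := by linarith
  have hev := (continuousOn_denoiserCoeff hI ε hε1).eventually (gt_mem_nhds hlt)
  obtain ⟨r, hr, H⟩ := Metric.mem_nhdsWithin_iff.1 hev
  refine ⟨ε, hε, -(denoiserCoeff α β ε / 2), by linarith, r, hr, fun t ht htr => ?_⟩
  have : denoiserCoeff α β t < denoiserCoeff α β ε / 2 := H ⟨by simpa [Real.dist_eq] using htr, ht⟩
  have := neg_le_abs (denoiserCoeff α β t)
  linarith

end Conclusion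

theorem mainTheorem1 (α β : ℝ → ℝ) (hαβ : IsInterpolant α β)
    (R : ℝ) (L : ℝ → ℝ) (M : ℝ → ℝ → ℝ) (η : ℝ) (hη : 0 < η) :
    ∃ ε ∈ Ioo (0 : ℝ) 1, ∃ n : ℕ, 0 < n ∧
      ∀ (N : ℕ), 0 < N → ∀ (P₀ : Measure (Euc N)), IsProbabilityMeasure P₀ →
        P₀.support ⊆ Metric.closedBall 0 (R * √N) →
        (∀ τ ∈ Ioo (0 : ℝ) 1, ∀ t ∈ Ioo τ 1, ∀ y : Euc N,
          ‖fderiv ℝ (fun y' => velocity α β P₀ t y') y‖ ≤ L τ) →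
        (∀ τ ∈ Ioo (0 : ℝ) 1, ∀ K > 0, ∀ t ∈ Ioo τ 1, ∀ y : Euc N, ‖y‖ ≤ K * √N →
          DifferentiableAt ℝ (fun s => velocity α β P₀ s y) t ∧
            ‖deriv (fun s => velocity α β P₀ s y) t‖ ≤ M τ K * √N) →
        wasserstein2 (algStateLaw α β P₀ ε n) P₀ / ENNReal.ofReal √N < ENNReal.ofReal η ∧
        wasserstein2 (algEstimateLaw α β P₀ ε n) P₀ / ENNReal.ofReal √N < ENNReal.ofReal η := by
  -- each mean-square error is at most `N η² / 16`; two of them, doubled, add up to `N η² / 4`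
  have he : 0 < η ^ 2 / 16 := by positivity
  obtain ⟨t₁, ht₁, hclose⟩ := exists_time_interpolant_close hαβ R he
  obtain ⟨ε, hε, c₀, hc₀, r, hr, hcoeff⟩ :=
    exists_time_denoiserCoeff_ne_zero hαβ ht₁ fun t ht => (hclose t ht).1
  have hε01 : ε ∈ Ioo (0 : ℝ) 1 := ⟨hε.1, hε.2.trans ht₁.2⟩
  obtain ⟨C, hC0, hC⟩ := exists_coeff_bound hαβ hε.1
  -- `κ` is a Lipschitz constant of the denoiser at times close to `ε`
  set κ := (|L (ε / 2)| + C) / c₀ with hκ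
  have hκ0 : 0 ≤ κ := by positivity
  set θ := η ^ 2 / 16 / (1 + κ ^ 2) with hθ
  have hθ0 : 0 < θ := by positivity
  have hθκ : (1 + κ ^ 2) * θ = η ^ 2 / 16 := by rw [hθ]; field_simp
  have hθ1 : θ ≤ η ^ 2 / 16 := by nlinarith [mul_nonneg (sq_nonneg κ) hθ0.le]
  have hθ2 : κ ^ 2 * θ ≤ η ^ 2 / 16 := by nlinarith
  obtain ⟨δ₀, hδ₀, hlim⟩ := exists_limitState hαβ R L M hε01 hθ0
  have hmin : 0 < min δ₀ (min r (t₁ - ε)) := lt_min hδ₀ (lt_min hr (by linarith [hε.2]))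
  obtain ⟨n, hn⟩ := exists_nat_gt ((1 - ε) / min δ₀ (min r (t₁ - ε)))
  have hε1 : 0 < 1 - ε := by linarith [hε01.2]
  have hn0 : (0 : ℝ) < n := (div_pos hε1 hmin).trans hn
  have hnpos : 0 < n := by exact_mod_cast hn0
  refine ⟨ε, hε01, n, hnpos, fun N hN P₀ hprob hsupp hL hM => ?_⟩
  set δ := (1 - ε) / n with hδ
  have hδpos : 0 < δ := div_pos hε1 hn0
  have hδmin : δ < min δ₀ (min r (t₁ - ε)) := by
    rw [hδ, div_lt_iff₀ hn0, mul_comm, ← div_lt_iff₀ hmin]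
    exact hn
  have hδ1 : δ < δ₀ := hδmin.trans_le (min_le_left _ _)
  have hδ2 : δ < r := hδmin.trans_le ((min_le_right _ _).trans (min_le_left _ _))
  have hδ3 : δ < t₁ - ε := hδmin.trans_le ((min_le_right _ _).trans (min_le_right _ _))
  have hnδ : n * δ = 1 - ε := by rw [hδ]; field_simp
  have hP := ae_norm_le_of_support_subset hsupp
  have hNr : (0 : ℝ) < N := by exact_mod_cast hN
  have hτ : ε / 2 ∈ Ioo (0 : ℝ) 1 := ⟨by linarith [hε.1], by linarith [hε01.1, hε01.2]⟩
  have hlim' := hlim N hN P₀ hprob hP (hL _ hτ) (hM _ hτ) δ hδpos.le hδ1.le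
  have hmse : ∀ t ∈ Ioc 0 t₁,
      ∫ p, ‖noisyState α β t p - p.1‖ ^ 2 ∂(P₀.prod (stdGaussian (Euc N))) ≤ N * (η ^ 2 / 16) := by
    intro t ht
    refine (integral_norm_noisyState_sub_sq_le hP t).trans ?_
    have e : 2 * (1 - α t) ^ 2 * (R * √N) ^ 2 + 2 * β t ^ 2 * N =
        N * (2 * (1 - α t) ^ 2 * R ^ 2 + 2 * β t ^ 2) := by
      rw [mul_pow, Real.sq_sqrt hNr.le]; ring
    rw [e]
    exact mul_le_mul_of_nonneg_left (hclose t ht).2.le hNr.le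
  constructor
  · obtain ⟨X, hX, hXY, hdist⟩ := hlim' n hnδ.le
    have ht : 1 - n * δ ∈ Ioc 0 t₁ := ⟨by linarith [hε.1], by linarith [hε.2]⟩
    refine wasserstein2_div_lt_of_limitState hN (Φ := id) hθ0.le he.le hη (by linarith)
      (continuous_algState hP δ n).measurable measurable_id hX
      (continuous_noisyState _).measurable hXY hdist ?_
    simp only [id]
    rw [← ofReal_integral_eq_lintegral_ofReal (integrable_norm_noisyState_sub_sq hP _)
      (Filter.Eventually.of_forall fun p => sq_nonneg _)]
    exact ENNReal.ofReal_le_ofReal (hmse _ ht)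
  · -- the last estimate is computed one step before the end, at time `ε + δ`
    have hcast : ((n - 1 : ℕ) : ℝ) = n - 1 := by rw [Nat.cast_sub hnpos, Nat.cast_one]
    have htime : 1 - ((n - 1 : ℕ) : ℝ) * δ = ε + δ := by rw [hcast]; linarith
    obtain ⟨X, hX, hXY, hdist⟩ := hlim' (n - 1) (by linarith)
    have htε : 1 - ((n - 1 : ℕ) : ℝ) * δ ∈ Icc ε 1 := by
      rw [htime]
      exact ⟨by linarith, by linarith [ht₁.2]⟩
    have ht : 1 - ((n - 1 : ℕ) : ℝ) * δ ∈ Ioc 0 t₁ := by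
      rw [htime]
      exact ⟨by linarith [hε.1], by linarith⟩
    have hc := hcoeff _ ⟨ht.1, htε.2⟩
      (by rw [htime, add_sub_cancel_left, abs_of_pos hδpos]; exact hδ2)
    have hLip := norm_denoiser_sub_le (P₀ := P₀) hP hc₀ hc (hC _ htε).2.1 fun y y' =>
      (norm_velocity_sub_le_of_fderiv hαβ hP hε01 (hL _ hτ) _ htε y y').trans
        (mul_le_mul_of_nonneg_right (le_abs_self _) (norm_nonneg _))
    set t := 1 - ((n - 1 : ℕ) : ℝ) * δ with htdef
    have hden := (continuous_denoiser (α := α) (β := β) hP t).measurable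
    refine wasserstein2_div_lt_of_limitState hN (Φ := denoiser α β P₀ t) (θ₁ := η ^ 2 / 16)
      he.le he.le hη (by linarith [sq_pos_of_pos hη])
      (hden.comp (continuous_algState hP δ (n - 1)).measurable) hden hX
      (continuous_noisyState _).measurable hXY ?_ ?_
    · calc ∫⁻ z, ENNReal.ofReal (‖algEstimate α β P₀ δ (n - 1) z - denoiser α β P₀ t (X z)‖ ^ 2)
            ∂(stdGaussian (Euc N))
          ≤ ∫⁻ z, ENNReal.ofReal (κ ^ 2) *
            ENNReal.ofReal (‖algState α β P₀ δ (n - 1) z - X z‖ ^ 2) ∂(stdGaussian (Euc N)) := by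
            refine lintegral_mono fun z => ?_
            rw [← ENNReal.ofReal_mul (sq_nonneg κ), ← mul_pow]
            refine ENNReal.ofReal_le_ofReal ?_
            exact pow_le_pow_left₀ (norm_nonneg _) (hLip (X z) _) 2
        _ ≤ ENNReal.ofReal (κ ^ 2) * ENNReal.ofReal (N * θ) := by
            rw [lintegral_const_mul' _ _ ENNReal.ofReal_ne_top]
            gcongr
        _ ≤ ENNReal.ofReal (N * (η ^ 2 / 16)) := by
            rw [← ENNReal.ofReal_mul (sq_nonneg κ)]
            refine ENNReal.ofReal_le_ofReal ?_
            calc κ ^ 2 * (N * θ) = N * (κ ^ 2 * θ) := by ring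
              _ ≤ _ := mul_le_mul_of_nonneg_left hθ2 hNr.le
    · obtain ⟨hint, hle⟩ := integral_norm_denoiser_sub_sq_le (α := α) hP
        (hαβ.beta_pos t ⟨ht.1, htε.2⟩)
      rw [← ofReal_integral_eq_lintegral_ofReal hint
        (Filter.Eventually.of_forall fun p => sq_nonneg _)]
      exact ENNReal.ofReal_le_ofReal (hle.trans (hmse t ht))
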